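/- Let $A,J\in\mathbb{R}^{n\times n}$, $B_c\in\mathbb{R}^{n\times m_c}$, $B_d\in\mathbb{R}^{n\times m_d}$ and $\bar T>0$. Consider the impulsive system $$\dot x(t)=Ax(t)+B_cu_c(t)\ \ (t\neq t_k),\qquad x(t_k)=Jx^-(t_k)+B_du_d(t_k),$$ where $x^-(t_k)=\lim_{s\uparrow t_k}x(s)$, under the feedback $u_c(t_k+\tau)=K_c(\tau)x(t_k+\tau)$ for $0\le\tau<T_k:=t_{k+1}-t_k$ and $u_d(t_k)=K_dx^-(t_k)$, where $K_c(\tau)=\tilde K_c(\tau)$ for $\tau<\bar T$ and $K_c(\tau)=\tilde K_c(\bar T)$ for $\tau\ge\bar T$. Write $\mathrm{He}(M)=M+M^T$ and let $\mathbb{S}^n$ be the set of real symmetric $n\times n$ matrices. The following statements are equivalent. (a) There exist $P\in\mathbb{S}^n$ with $P\succ0$, $K_d\in\mathbb{R}^{m_d\times n}$ and a continuous $\tilde K_c:[0,\bar T]\to\mathbb{R}^{m_c\times n}$ such that $$(A+B_c\tilde K_c(\bar T))^TP+P(A+B_c\tilde K_c(\bar T))\prec0,\qquad (J+B_dK_d)^T\Phi(\bar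 T)^TP\,\Phi(\bar T)(J+B_dK_d)-P\prec0,$$ where $\Phi:[0,\infty)\to\mathbb{R}^{n\times n}$ is the solution of $\Phi'(\tau)=[A+B_cK_c(\tau)]\Phi(\tau)$, $\tau\ge0$, $\Phi(0)=I$. (b) There exist a differentiable $S:[0,\bar T]\to\mathbb{S}^n$ with $S(\bar T)\succ0$, a continuous $U_c:[0,\bar T]\to\mathbb{R}^{m_c\times n}$, a matrix $U_d\in\mathbb{R}^{m_d\times n}$ and a scalar $\varepsilon>0$ such that, for all $\tau\in[0,\bar T]$, $$\mathrm{He}[AS(\bar T)+B_cU_c(\bar T)]\prec0,\qquad \mathrm{He}[AS(\tau)+B_cU_c(\tau)]-\dot S(\tau)\preceq0,$$ $$\begin{bmatrix}-S(0)+\varepsilon I & JS(\bar T)+B_dU_d\\ (JS(\bar T)+B_dU_d)^T & -S(\bar T)\end{bmatrix}\preceq0 .$$ If (b) holds, then it also holds with some $(S,U_c,U_d,\varepsilon)$ for which $S(\tau)$ is invertible for all $\tau\in[0,\bar T]$. For every solution of (b) with this property, the gains $\tilde K_c(\tau)=U_c(\tau)S(\tau)^{-1}$ and $K_d=U_dS(\bar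 T)^{-1}$ satisfy the inequalities in (a) for some $P\succ0$. Moreover, for all $P,K_d,\tilde K_c$ as in (a), the closed-loop system is asymptotically stable under minimum dwell-time $\bar T$: for every sequence of impulse instants (infinite, or finite, in which case the last gain is held forever) with $T_k\ge\bar T$ for all $k$, and from every initial time not before $t_0$, the origin is stable and every trajectory converges to $0$ as $t\to\infty$. -/

import Mathlib

open Set Filter Topology
open scoped Matrix

namespace Impulsive

/-- `M` is the derivative at `τ` of the matrix function `F`, relative to `D` (entry by entry). -/
def HasMatrixDerivWithinAt {p q : ℕ} (F : ℝ → Matrix (Fin p) (Fin q) ℝ)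
    (M : Matrix (Fin p) (Fin q) ℝ) (D : Set ℝ) (τ : ℝ) : Prop :=
  ∀ i j, HasDerivWithinAt (fun σ => F σ i j) (M i j) D τ

/-- `He(M) = M + Mᵀ`. -/
def He {p : ℕ} (M : Matrix (Fin p) (Fin p) ℝ) : Matrix (Fin p) (Fin p) ℝ := M + Mᵀ

/-- `M ≺ 0`. -/
def NegDef {ι : Type} (M : Matrix ι ι ℝ) : Prop := (-M).PosDef

/-- `M ⪯ 0`. -/
def NegSemidef {ι : Type} (M : Matrix ι ι ℝ) : Prop := (-M).PosSemidef

/-- The continuous-time gain as a function of the time `τ` elapsed since the last impulse: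
`K τ` for `τ < T`, frozen at `K T` for `τ ≥ T`. -/
noncomputable def heldGain {m n : ℕ} (T : ℝ) (K : ℝ → Matrix (Fin m) (Fin n) ℝ) (τ : ℝ) :
    Matrix (Fin m) (Fin n) ℝ :=
  if τ < T then K τ else K T

/-- `Φ` is the transition matrix on `[0,∞)`: `Φ' = (A + Bc Kc(τ)) Φ` for `τ ≥ 0`, `Φ(0) = I`. -/
def IsTransitionMatrix {n mc : ℕ} (A : Matrix (Fin n) (Fin n) ℝ) (Bc : Matrix (Fin n) (Fin mc) ℝ)
    (Kc : ℝ → Matrix (Fin mc) (Fin n) ℝ) (Φ : ℝ → Matrix (Fin n) (Fin n) ℝ) : Prop :=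
  Φ 0 = 1 ∧ ∀ τ, 0 ≤ τ → HasMatrixDerivWithinAt Φ ((A + Bc * Kc τ) * Φ τ) (Ici 0) τ

/-- The matrix inequalities on `(P, K_d, K)`, where `K` is a continuous gain on `[0,T]`. -/
structure DwellTimeConditions {n mc md : ℕ} (A J : Matrix (Fin n) (Fin n) ℝ)
    (Bc : Matrix (Fin n) (Fin mc) ℝ) (Bd : Matrix (Fin n) (Fin md) ℝ) (T : ℝ)
    (P : Matrix (Fin n) (Fin n) ℝ) (Kd : Matrix (Fin md) (Fin n) ℝ)
    (K : ℝ → Matrix (Fin mc) (Fin n) ℝ) : Prop where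
  posDef : P.PosDef
  continuousOn : ContinuousOn K (Icc 0 T)
  flow : NegDef ((A + Bc * K T)ᵀ * P + P * (A + Bc * K T))
  jump : ∃ Φ : ℝ → Matrix (Fin n) (Fin n) ℝ, IsTransitionMatrix A Bc (heldGain T K) Φ ∧
    NegDef ((J + Bd * Kd)ᵀ * (Φ T)ᵀ * P * Φ T * (J + Bd * Kd) - P)

/-- The linear matrix inequalities in `(S, U_c, U_d, ε)`. -/
structure DwellTimeLMIs {n mc md : ℕ} (A J : Matrix (Fin n) (Fin n) ℝ)
    (Bc : Matrix (Fin n) (Fin mc) ℝ) (Bd : Matrix (Fin n) (Fin md) ℝ) (T : ℝ)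
    (S : ℝ → Matrix (Fin n) (Fin n) ℝ) (Uc : ℝ → Matrix (Fin mc) (Fin n) ℝ)
    (Ud : Matrix (Fin md) (Fin n) ℝ) (ε : ℝ) : Prop where
  symm : ∀ τ ∈ Icc 0 T, (S τ).IsSymm
  posDef : (S T).PosDef
  continuousOn : ContinuousOn Uc (Icc 0 T)
  eps_pos : 0 < ε
  terminal : NegDef (He (A * S T + Bc * Uc T))
  flow : ∃ S' : ℝ → Matrix (Fin n) (Fin n) ℝ, ∀ τ ∈ Icc 0 T,
    HasMatrixDerivWithinAt S (S' τ) (Icc 0 T) τ ∧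
      NegSemidef (He (A * S τ + Bc * Uc τ) - S' τ)
  jump : NegSemidef (Matrix.fromBlocks
    (-(S 0) + ε • (1 : Matrix (Fin n) (Fin n) ℝ)) (J * S T + Bd * Ud)
    (J * S T + Bd * Ud)ᵀ (-(S T)))

/-- The instants `t 0, t 1, …` (those `t k` with `k ≤ N`, where `N = ⊤` means infinitely many
impulses and `N < ⊤` means that impulses stop after the `N`-th one) have all their dwell-times
`t (k+1) - t k` at least `T`. -/
def HasMinDwellTime (T : ℝ) (N : ℕ∞) (t : ℕ → ℝ) : Prop :=
  ∀ k : ℕ, ((k + 1 : ℕ) : ℕ∞) ≤ N → T ≤ t (k + 1) - t k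

/-- `τ` lies in the `k`-th inter-impulse interval `[t k, t (k+1))`
(`[t k, ∞)` if the `k`-th impulse is the last one). -/
def InInterval (N : ℕ∞) (t : ℕ → ℝ) (k : ℕ) (τ : ℝ) : Prop :=
  (k : ℕ∞) ≤ N ∧ t k ≤ τ ∧ (((k + 1 : ℕ) : ℕ∞) ≤ N → τ < t (k + 1))

/-- `x` is, on `[s,∞)`, a trajectory of the impulsive system
`x' = A x + Bc u_c` (between impulses), `x(t_k) = J x⁻(t_k) + Bd u_d(t_k)`
under the feedback `u_c(t_k + τ) = Kc(τ) x(t_k + τ)`, `u_d(t_k) = Kd x⁻(t_k)`. -/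
structure IsTrajectory {n mc md : ℕ} (A J : Matrix (Fin n) (Fin n) ℝ)
    (Bc : Matrix (Fin n) (Fin mc) ℝ) (Bd : Matrix (Fin n) (Fin md) ℝ)
    (Kc : ℝ → Matrix (Fin mc) (Fin n) ℝ) (Kd : Matrix (Fin md) (Fin n) ℝ)
    (N : ℕ∞) (t : ℕ → ℝ) (s : ℝ) (x : ℝ → Fin n → ℝ) : Prop where
  /-- right-continuity, at impulses and at the initial time -/
  rightCont : ∀ τ, s ≤ τ → ContinuousWithinAt x (Ici τ) τ
  /-- flow strictly between impulses -/
  flow : ∀ (k : ℕ) (τ : ℝ), InInterval N t k τ → t k < τ → s < τ →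
    HasDerivAt x (A *ᵥ x τ + Bc *ᵥ (Kc (τ - t k) *ᵥ x τ)) τ
  /-- jump, with the left limit `xm = x⁻(t_k)` -/
  jump : ∀ k : ℕ, (k : ℕ∞) ≤ N → s < t k →
    ∃ xm : Fin n → ℝ, Tendsto x (𝓝[<] (t k)) (𝓝 xm) ∧
      x (t k) = J *ᵥ xm + Bd *ᵥ (Kd *ᵥ xm)

/-- Asymptotic stability of the closed loop for the given impulse instants: from every initial
time `s ≥ t 0`, the origin is stable and all trajectories converge to it. (The norm on the
state space is immaterial, since the dimension is finite.) -/
def AsymptoticallyStable {n mc md : ℕ} (A J : Matrix (Fin n) (Fin n) ℝ)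
    (Bc : Matrix (Fin n) (Fin mc) ℝ) (Bd : Matrix (Fin n) (Fin md) ℝ)
    (Kc : ℝ → Matrix (Fin mc) (Fin n) ℝ) (Kd : Matrix (Fin md) (Fin n) ℝ)
    (N : ℕ∞) (t : ℕ → ℝ) : Prop :=
  ∀ s, t 0 ≤ s →
    (∀ η > 0, ∃ δ > 0, ∀ x, IsTrajectory A J Bc Bd Kc Kd N t s x → ‖x s‖ < δ →
      ∀ τ, s ≤ τ → ‖x τ‖ < η) ∧
    (∀ x, IsTrajectory A J Bc Bd Kc Kd N t s x → Tendsto x atTop (𝓝 0))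

/-- Asymptotic stability under minimum dwell-time `T`. -/
def StableUnderMinDwellTime {n mc md : ℕ} (A J : Matrix (Fin n) (Fin n) ℝ)
    (Bc : Matrix (Fin n) (Fin mc) ℝ) (Bd : Matrix (Fin n) (Fin md) ℝ) (T : ℝ)
    (Kc : ℝ → Matrix (Fin mc) (Fin n) ℝ) (Kd : Matrix (Fin md) (Fin n) ℝ) : Prop :=
  ∀ (N : ℕ∞) (t : ℕ → ℝ), HasMinDwellTime T N t → AsymptoticallyStable A J Bc Bd Kc Kd N t

end Impulsive

/-! Write `Ψ` for the inverse of the transition matrix `Φ`. Conditions and LMIs are linked by `S(T)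
= P⁻¹`, `U = K S`, transport of quadratic forms along `Φ` and `Ψ`, and a Schur complement swap
(`posDef_schur_swap`), which exchanges an inequality on `P` for one on `P⁻¹`.

From gains to LMIs, let `S` solve the flow inequality with equality: `S = Φ R Φᵀ`, with `R` chosen
so that `S(T) = P⁻¹`. The swapped jump inequality is strict, which leaves room for `ε`. From LMIs to
gains, with `S` invertible, the flow inequality makes `Ψ S Ψᵀ` nondecreasing, so `S(0)` is at most
`Ψ(T) S(T) Ψ(T)ᵀ`, whose inverse is `Φ(T)ᵀ P Φ(T)`. The jump LMI, made strict by `ε`, then swaps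
back.

A solution `S` of the LMIs can be singular at interior times, since `U_c` need not factor through
it. Adding `c` times the Gramian carried back to the original coordinates, and subtracting `(c/2)
Bcᵀ` from `U_c`, leaves the flow residual unchanged and preserves the other LMIs. In the coordinates
`exp(-τA) x`, on the kernel of the Gramian the input has no effect, so there the form of `S` grows
from the positive form of `S(0)`. A large `c` handles all other directions
(`exists_quad_add_smul_pos`).

For stability, pull `Φ(T)ᵀ P Φ(T)` back by `Ψ` and freeze it after `T`. This clock-dependent
Lyapunov function is constant for time `T` after an impulse, then decays, and contracts by a fixed
factor at the next impulse. -/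

namespace Impulsive

/-! ### Quadratic forms -/

/-- The quadratic form `vᵀ M v`. -/
def quad {ι : Type} [Fintype ι] (M : Matrix ι ι ℝ) (v : ι → ℝ) : ℝ := v ⬝ᵥ (M *ᵥ v)

section quad

variable {ι κ : Type} [Fintype ι] [Fintype κ]

theorem quad_add (M N : Matrix ι ι ℝ) (v : ι → ℝ) : quad (M + N) v = quad M v + quad N v := by
  simp [quad, Matrix.add_mulVec]

theorem quad_sub (M N : Matrix ι ι ℝ) (v : ι → ℝ) : quad (M - N) v = quad M v - quad N v := by
  simp [quad, Matrix.sub_mulVec]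

theorem quad_neg (M : Matrix ι ι ℝ) (v : ι → ℝ) : quad (-M) v = -quad M v := by
  simp [quad, Matrix.neg_mulVec]

theorem quad_matrix_smul (c : ℝ) (M : Matrix ι ι ℝ) (v : ι → ℝ) :
    quad (c • M) v = c * quad M v := by
  simp [quad, Matrix.smul_mulVec]

theorem quad_smul (M : Matrix ι ι ℝ) (c : ℝ) (v : ι → ℝ) : quad M (c • v) = c ^ 2 * quad M v := by
  simp [quad, Matrix.mulVec_smul]; ring

theorem quad_zero (v : ι → ℝ) : quad (0 : Matrix ι ι ℝ) v = 0 := by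
  simp [quad]

theorem quad_transpose (M : Matrix ι ι ℝ) (v : ι → ℝ) : quad Mᵀ v = quad M v := by
  unfold quad
  rw [Matrix.mulVec_transpose, Matrix.dotProduct_mulVec, dotProduct_comm]

theorem quad_congr (M : Matrix ι ι ℝ) (N : Matrix ι κ ℝ) (v : κ → ℝ) :
    quad (Nᵀ * M * N) v = quad M (N *ᵥ v) := by
  unfold quad
  rw [← Matrix.mulVec_mulVec, ← Matrix.mulVec_mulVec, Matrix.dotProduct_mulVec,
    Matrix.vecMul_transpose]

theorem quad_congr' (M : Matrix ι ι ℝ) (N : Matrix κ ι ℝ) (v : κ → ℝ) :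
    quad (N * M * Nᵀ) v = quad M (Nᵀ *ᵥ v) := by
  simpa using quad_congr M Nᵀ v

theorem quad_mul_transpose (N : Matrix ι κ ℝ) (v : ι → ℝ) :
    quad (N * Nᵀ) v = (Nᵀ *ᵥ v) ⬝ᵥ (Nᵀ *ᵥ v) := by
  unfold quad
  rw [← Matrix.mulVec_mulVec, Matrix.dotProduct_mulVec, ← Matrix.mulVec_transpose]

theorem posDef_iff_quad {M : Matrix ι ι ℝ} :
    M.PosDef ↔ M.IsSymm ∧ ∀ v ≠ 0, 0 < quad M v := by
  rw [Matrix.posDef_iff_dotProduct_mulVec, ← Matrix.isHermitian_iff_isSymm]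
  simp [quad]

theorem posSemidef_iff_quad {M : Matrix ι ι ℝ} :
    M.PosSemidef ↔ M.IsSymm ∧ ∀ v, 0 ≤ quad M v := by
  rw [Matrix.posSemidef_iff_dotProduct_mulVec, ← Matrix.isHermitian_iff_isSymm]
  simp [quad]

theorem continuous_quad : Continuous fun p : Matrix ι ι ℝ × (ι → ℝ) => quad p.1 p.2 :=
  continuous_snd.dotProduct (continuous_fst.matrix_mulVec continuous_snd)

theorem continuousOn_quad {F : ℝ → Matrix ι ι ℝ} {D : Set ℝ} (hF : ContinuousOn F D)
    (s : Set (ι → ℝ)) : ContinuousOn (fun p : ℝ × (ι → ℝ) => quad (F p.1) p.2) (D ×ˢ s) :=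
  continuous_quad.comp_continuousOn
    ((hF.comp continuousOn_fst fun _ hp => hp.1).prodMk continuousOn_snd)

theorem quad_eq_norm_sq_mul {v : ι → ℝ} (hv : v ≠ 0) (M : Matrix ι ι ℝ) :
    quad M v = ‖v‖ ^ 2 * quad M (‖v‖⁻¹ • v) := by
  rw [quad_smul, ← mul_assoc, ← mul_pow, mul_inv_cancel₀ (norm_ne_zero_iff.2 hv)]; simp

theorem inv_norm_smul_mem_sphere {v : ι → ℝ} (hv : v ≠ 0) :
    ‖v‖⁻¹ • v ∈ Metric.sphere (0 : ι → ℝ) 1 := by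
  simp [norm_smul, norm_ne_zero_iff.2 hv]

/-- A continuous family of quadratic forms on a compact set is uniformly bounded. -/
theorem exists_quad_le {F : ℝ → Matrix ι ι ℝ} {D : Set ℝ} (hD : IsCompact D)
    (hF : ContinuousOn F D) :
    ∃ C > 0, ∀ τ ∈ D, ∀ v, |quad (F τ) v| ≤ C * ‖v‖ ^ 2 := by
  obtain ⟨C, hC⟩ := ((hD.prod (isCompact_sphere (0 : ι → ℝ) 1)).image_of_continuousOn
    (continuousOn_quad hF _)).isBounded.exists_norm_le
  refine ⟨max C 1, by positivity, fun τ hτ v => ?_⟩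
  rcases eq_or_ne v 0 with rfl | hv
  · simp [quad]
  · have h := hC _ ⟨(τ, ‖v‖⁻¹ • v), ⟨hτ, inv_norm_smul_mem_sphere hv⟩, rfl⟩
    rw [quad_eq_norm_sq_mul hv, abs_mul, abs_of_nonneg (sq_nonneg _), mul_comm]
    exact mul_le_mul_of_nonneg_right (h.trans (le_max_left _ _)) (sq_nonneg _)

/-- A continuous family of positive definite forms on a compact set is uniformly positive. -/
theorem exists_le_quad {F : ℝ → Matrix ι ι ℝ} {D : Set ℝ} (hD : IsCompact D)
    (hF : ContinuousOn F D) (hpos : ∀ τ ∈ D, ∀ v ≠ 0, 0 < quad (F τ) v) :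
    ∃ c > (0 : ℝ), ∀ τ ∈ D, ∀ v, c * ‖v‖ ^ 2 ≤ quad (F τ) v := by
  obtain ⟨c, hc, h⟩ := (hD.prod (isCompact_sphere (0 : ι → ℝ) 1)).exists_forall_le'
    (continuousOn_quad hF _) (a := 0) fun p hp =>
      hpos p.1 hp.1 p.2 (by rintro h0; have := hp.2; simp [h0] at this)
  refine ⟨c, hc, fun τ hτ v => ?_⟩
  rcases eq_or_ne v 0 with rfl | hv
  · simp [quad]
  · rw [quad_eq_norm_sq_mul hv, mul_comm]
    exact mul_le_mul_of_nonneg_left (h (τ, ‖v‖⁻¹ • v) ⟨hτ, inv_norm_smul_mem_sphere hv⟩)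
      (sq_nonneg _)

/-- If `F` is positive on the kernel of `G ⪰ 0`, then `F + c G` is positive for large `c`,
uniformly on compact sets. -/
theorem exists_quad_add_smul_pos {F G : ℝ → Matrix ι ι ℝ} {D : Set ℝ} (hD : IsCompact D)
    (hF : ContinuousOn F D) (hG : ContinuousOn G D) (hG0 : ∀ τ ∈ D, ∀ v, 0 ≤ quad (G τ) v)
    (hFG : ∀ τ ∈ D, ∀ v ≠ 0, quad (G τ) v = 0 → 0 < quad (F τ) v) :
    ∃ c > (0 : ℝ), ∀ τ ∈ D, ∀ v ≠ 0, 0 < quad (F τ + c • G τ) v := by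
  set s := Metric.sphere (0 : ι → ℝ) 1
  have hs : ∀ v ∈ s, v ≠ 0 := by rintro v hv rfl; simp [s] at hv
  have hK : IsCompact (D ×ˢ s) := hD.prod (isCompact_sphere _ _)
  obtain ⟨B, hB0, hB⟩ := exists_quad_le hD hF
  have hcl : IsCompact ((D ×ˢ s) ∩ (fun p : ℝ × (ι → ℝ) => quad (F p.1) p.2) ⁻¹' Iic 0) :=
    hK.of_isClosed_subset ((continuousOn_quad hF s).preimage_isClosed_of_isClosed hK.isClosed
      isClosed_Iic) inter_subset_left
  -- The part of `D` times the sphere where `F ≤ 0` is compact and `G > 0` on it, so `G ≥ m > 0`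
  -- there.
  obtain ⟨m, hm, h⟩ := hcl.exists_forall_le' (a := 0)
    ((continuousOn_quad hG s).mono inter_subset_left) fun p hp =>
      lt_of_le_of_ne (hG0 _ hp.1.1 _) fun h0 =>
        absurd (hFG _ hp.1.1 _ (hs _ hp.1.2) h0.symm) (not_lt.2 hp.2)
  -- Where `F ≤ 0` one has `F ≥ -B` and `c G ≥ B + 1`; elsewhere `F` alone is positive.
  have hc : 0 < (B + 1) / m := by positivity
  refine ⟨(B + 1) / m, hc, fun τ hτ v hv => ?_⟩
  rw [quad_eq_norm_sq_mul hv]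
  have hn : 0 < ‖v‖ := norm_pos_iff.2 hv
  refine mul_pos (by positivity) ?_
  have hu := inv_norm_smul_mem_sphere hv
  set u := ‖v‖⁻¹ • v
  rw [quad_add, quad_matrix_smul]
  have hg := mul_nonneg hc.le (hG0 τ hτ u)
  by_cases hf : quad (F τ) u ≤ 0
  · have h1 := mul_le_mul_of_nonneg_left (h (τ, u) ⟨⟨hτ, hu⟩, hf⟩) hc.le
    have h2 := hB τ hτ u
    rw [div_mul_cancel₀ _ hm.ne'] at h1
    have h3 : ‖u‖ = 1 := by simpa using hu
    rw [h3] at h2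
    have := (abs_le.1 h2).1
    simp only at h1
    linarith
  · linarith [not_le.1 hf]

/-- Any quadratic form is dominated by a multiple of a positive definite one. -/
theorem exists_mul_quad_le {X : Matrix ι ι ℝ} (hX : X.PosDef) (Y : Matrix ι ι ℝ) :
    ∃ μ > (0 : ℝ), ∀ v, μ * quad Y v ≤ quad X v := by
  obtain ⟨c, hc, h⟩ := exists_le_quad (isCompact_singleton (x := (0 : ℝ)))
    (continuousOn_const (c := X)) fun _ _ => (posDef_iff_quad.1 hX).2
  obtain ⟨C, hC, h'⟩ := exists_quad_le (isCompact_singleton (x := (0 : ℝ)))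
    (continuousOn_const (c := Y))
  refine ⟨c / C, by positivity, fun v => ?_⟩
  have h1 := h 0 rfl v
  have h2 := mul_le_mul_of_nonneg_left ((le_abs_self _).trans (h' 0 rfl v)) (div_pos hc hC).le
  rw [← mul_assoc, div_mul_cancel₀ _ hC.ne'] at h2
  linarith

/-- Source of the slack `ε` in the jump LMI. -/
theorem exists_posSemidef_sub_smul_one [DecidableEq ι] {M : Matrix ι ι ℝ} (hM : M.PosDef) :
    ∃ ε > (0 : ℝ), (M - ε • (1 : Matrix ι ι ℝ)).PosSemidef := by
  obtain ⟨ε, hε, h⟩ := exists_mul_quad_le hM 1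
  refine ⟨ε, hε, posSemidef_iff_quad.2 ⟨?_, fun v => ?_⟩⟩
  · simp [Matrix.IsSymm, (posDef_iff_quad.1 hM).1.eq]
  · rw [quad_sub, quad_matrix_smul]
    linarith [h v]

/-- Schur complements: if `Y - Nᵀ X⁻¹ N ≻ 0` with `X, Y ≻ 0`, then `X - N Y⁻¹ Nᵀ ≻ 0`. -/
theorem posDef_schur_swap [DecidableEq ι] [DecidableEq κ] {X : Matrix ι ι ℝ} {Y : Matrix κ κ ℝ}
    (hX : X.PosDef) (hY : Y.PosDef) (N : Matrix ι κ ℝ) (h : (Y - Nᵀ * X⁻¹ * N).PosDef) :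
    (X - N * Y⁻¹ * Nᵀ).PosDef := by
  let := hX.isUnit.invertible
  let := hY.isUnit.invertible
  have h1 : (X - N * Y⁻¹ * Nᵀ).PosSemidef := by
    have h2 := (Matrix.PosDef.fromBlocks₁₁ N Y hX).2
      (by simpa [Matrix.conjTranspose_eq_transpose_of_trivial] using h.posSemidef)
    simpa [Matrix.conjTranspose_eq_transpose_of_trivial] using
      (Matrix.PosDef.fromBlocks₂₂ X N hY).1 h2
  -- The block matrix gives only semidefiniteness. Its determinant, computed through either Schur
  -- complement, shows that the new complement is invertible, hence definite.
  rw [h1.posDef_iff_isUnit, Matrix.isUnit_iff_isUnit_det]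
  have e1 := Matrix.det_fromBlocks₁₁ X N Nᵀ Y
  have e2 := Matrix.det_fromBlocks₂₂ X N Nᵀ Y
  rw [Matrix.invOf_eq_nonsing_inv] at e1 e2
  rw [e1] at e2
  refine isUnit_of_mul_isUnit_right (x := Y.det) ?_
  rw [← e2]
  exact ((Matrix.isUnit_iff_isUnit_det _).1 hX.isUnit).mul
    ((Matrix.isUnit_iff_isUnit_det _).1 h.isUnit)

end quad

/-! ### Derivatives of matrix functions -/

namespace HasMatrixDerivWithinAt

variable {p q r : ℕ} {F : ℝ → Matrix (Fin p) (Fin q) ℝ} {F' : Matrix (Fin p) (Fin q) ℝ}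
  {D : Set ℝ} {τ : ℝ}

theorem mono {D' : Set ℝ} (h : HasMatrixDerivWithinAt F F' D τ) (hD : D' ⊆ D) :
    HasMatrixDerivWithinAt F F' D' τ := fun i j => (h i j).mono hD

theorem const (M : Matrix (Fin p) (Fin q) ℝ) : HasMatrixDerivWithinAt (fun _ => M) 0 D τ :=
  fun _ _ => hasDerivWithinAt_const _ _ _

theorem add {G : ℝ → Matrix (Fin p) (Fin q) ℝ} {G' : Matrix (Fin p) (Fin q) ℝ}
    (hF : HasMatrixDerivWithinAt F F' D τ) (hG : HasMatrixDerivWithinAt G G' D τ) :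
    HasMatrixDerivWithinAt (fun σ => F σ + G σ) (F' + G') D τ :=
  fun i j => (hF i j).add (hG i j)

theorem const_smul (c : ℝ) (hF : HasMatrixDerivWithinAt F F' D τ) :
    HasMatrixDerivWithinAt (fun σ => c • F σ) (c • F') D τ :=
  fun i j => (hF i j).const_mul c

theorem transpose (hF : HasMatrixDerivWithinAt F F' D τ) :
    HasMatrixDerivWithinAt (fun σ => (F σ)ᵀ) F'ᵀ D τ := fun i j => hF j i

theorem mul {G : ℝ → Matrix (Fin q) (Fin r) ℝ} {G' : Matrix (Fin q) (Fin r) ℝ}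
    (hF : HasMatrixDerivWithinAt F F' D τ) (hG : HasMatrixDerivWithinAt G G' D τ) :
    HasMatrixDerivWithinAt (fun σ => F σ * G σ) (F' * G τ + F τ * G') D τ := by
  intro i j
  simp only [Matrix.mul_apply, Matrix.add_apply, ← Finset.sum_add_distrib]
  exact HasDerivWithinAt.fun_sum fun k _ => (hF i k).mul (hG k j)

theorem mulVec {x : ℝ → Fin q → ℝ} {x' : Fin q → ℝ} (hF : HasMatrixDerivWithinAt F F' D τ)
    (hx : HasDerivWithinAt x x' D τ) :
    HasDerivWithinAt (fun σ => F σ *ᵥ x σ) (F' *ᵥ x τ + F τ *ᵥ x') D τ := by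
  rw [hasDerivWithinAt_pi] at hx ⊢
  intro i
  simp only [Matrix.mulVec, dotProduct, Pi.add_apply, ← Finset.sum_add_distrib]
  exact HasDerivWithinAt.fun_sum fun k _ => (hF i k).mul (hx k)

theorem quad {G : ℝ → Matrix (Fin p) (Fin p) ℝ} {G' : Matrix (Fin p) (Fin p) ℝ}
    (hG : HasMatrixDerivWithinAt G G' D τ) (v : Fin p → ℝ) :
    HasDerivWithinAt (fun σ => quad (G σ) v) (quad G' v) D τ := by
  simp only [Impulsive.quad, Matrix.mulVec, dotProduct]
  exact HasDerivWithinAt.fun_sum fun i _ => HasDerivWithinAt.const_mul _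
    (HasDerivWithinAt.fun_sum fun j _ => (hG i j).mul_const _)

theorem continuousWithinAt (hF : HasMatrixDerivWithinAt F F' D τ) : ContinuousWithinAt F D τ :=
  continuousWithinAt_pi.2 fun i => continuousWithinAt_pi.2 fun j => (hF i j).continuousWithinAt

end HasMatrixDerivWithinAt

/-- Differentiability is asked only in the open interval because a trajectory is merely
right-continuous at an impulse. -/
theorem le_of_hasDerivAt_nonneg {f f' : ℝ → ℝ} {a b : ℝ} (hab : a ≤ b)
    (hf : ContinuousOn f (Icc a b)) (h : ∀ x ∈ Ioo a b, HasDerivAt f (f' x) x)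
    (h0 : ∀ x ∈ Ioo a b, 0 ≤ f' x) : f a ≤ f b := by
  refine monotoneOn_of_hasDerivWithinAt_nonneg (f' := f') (convex_Icc a b) hf ?_ ?_
    (left_mem_Icc.2 hab) (right_mem_Icc.2 hab) hab
  · rw [interior_Icc]
    exact fun x hx => (h x hx).hasDerivWithinAt
  · rwa [interior_Icc]

theorem le_of_hasDerivWithinAt_nonneg {f f' : ℝ → ℝ} {a b : ℝ} (hab : a ≤ b)
    (h : ∀ x ∈ Icc a b, HasDerivWithinAt f (f' x) (Icc a b) x)
    (h0 : ∀ x ∈ Icc a b, 0 ≤ f' x) : f a ≤ f b :=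
  le_of_hasDerivAt_nonneg hab (fun x hx => (h x hx).continuousWithinAt)
    (fun x hx => (h x (Ioo_subset_Icc_self hx)).hasDerivAt (Icc_mem_nhds hx.1 hx.2))
    fun x hx => h0 x (Ioo_subset_Icc_self hx)

theorem eq_of_hasDerivAt_zero {f : ℝ → ℝ} {a b : ℝ} (hab : a ≤ b)
    (hf : ContinuousOn f (Icc a b)) (h : ∀ x ∈ Ioo a b, HasDerivAt f 0 x) : f a = f b := by
  refine le_antisymm (le_of_hasDerivAt_nonneg hab hf h fun _ _ => le_rfl) ?_
  have := le_of_hasDerivAt_nonneg hab hf.neg (fun x hx => (h x hx).neg) fun _ _ => by simp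
  simpa using this

theorem eq_of_hasDerivWithinAt_zero {f : ℝ → ℝ} {a b : ℝ} (hab : a ≤ b)
    (h : ∀ x ∈ Icc a b, HasDerivWithinAt f 0 (Icc a b) x) : f a = f b :=
  eq_of_hasDerivAt_zero hab (fun x hx => (h x hx).continuousWithinAt)
    fun x hx => (h x (Ioo_subset_Icc_self hx)).hasDerivAt (Icc_mem_nhds hx.1 hx.2)

end Impulsive

namespace Impulsive

/-! ### Linear differential equations -/

section PeanoSeries

variable {𝔸 : Type*} [NormedRing 𝔸] [NormedAlgebra ℝ 𝔸]

/-- The terms of the Peano series solving `Φ' = M Φ`, `Φ 0 = 1`. -/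
noncomputable def peanoTerm (M : ℝ → 𝔸) : ℕ → ℝ → 𝔸
  | 0, _ => 1
  | k + 1, t => ∫ s in (0 : ℝ)..t, M s * peanoTerm M k s

variable {M : ℝ → 𝔸} {C : ℝ}

theorem continuous_peanoTerm (hM : Continuous M) (k : ℕ) : Continuous (peanoTerm M k) := by
  induction k with
  | zero => exact continuous_const
  | succ k ih =>
    exact intervalIntegral.continuous_primitive
      (fun a b => (hM.mul ih).intervalIntegrable a b) 0

theorem hasDerivAt_peanoTerm_succ [CompleteSpace 𝔸] (hM : Continuous M) (k : ℕ) (t : ℝ) :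
    HasDerivAt (peanoTerm M (k + 1)) (M t * peanoTerm M k t) t :=
  (hM.mul (continuous_peanoTerm hM k)).integral_hasStrictDerivAt 0 t |>.hasDerivAt

theorem norm_peanoTerm_le (hC : ∀ t, ‖M t‖ ≤ C) (k : ℕ) (t : ℝ) :
    ‖peanoTerm M k t‖ ≤ ‖(1 : 𝔸)‖ * ((C * |t|) ^ k / k.factorial) := by
  have hC0 : 0 ≤ C := (norm_nonneg _).trans (hC 0)
  induction k generalizing t with
  | zero => simp [peanoTerm]
  | succ k ih =>
    have h1 : ∀ s, ‖M s * peanoTerm M k s‖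
        ≤ C * (‖(1 : 𝔸)‖ * C ^ k / k.factorial) * |s - 0| ^ k := fun s => by
      refine (norm_mul_le _ _).trans ((mul_le_mul (hC s) (ih s) (norm_nonneg _) hC0).trans_eq ?_)
      rw [sub_zero, mul_pow]; ring
    rw [peanoTerm]
    rw [intervalIntegral.norm_integral_eq_norm_integral_uIoc]
    refine (MeasureTheory.norm_integral_le_of_norm_le ?_ (Eventually.of_forall h1)).trans ?_
    · have : Continuous fun s : ℝ => C * (‖(1 : 𝔸)‖ * C ^ k / k.factorial) * |s - 0| ^ k := by
        fun_prop
      exact (this.intervalIntegrable 0 t).def'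
    · rw [MeasureTheory.integral_const_mul, integral_pow_abs_sub_uIoc, sub_zero,
        Nat.factorial_succ]
      push_cast
      rw [mul_pow]
      apply le_of_eq
      field_simp
      ring

theorem exists_hasDerivAt_mul [CompleteSpace 𝔸] (hM : Continuous M) (hC : ∀ t, ‖M t‖ ≤ C) :
    ∃ Φ : ℝ → 𝔸, Φ 0 = 1 ∧ ∀ t, HasDerivAt Φ (M t * Φ t) t := by
  have hC0 : 0 ≤ C := (norm_nonneg _).trans (hC 0)
  have hsum : ∀ t, Summable fun k => peanoTerm M k t := fun t =>
    Summable.of_norm_bounded ((Real.summable_pow_div_factorial (C * |t|)).mul_left _)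
      (norm_peanoTerm_le hC · t)
  refine ⟨fun t => 1 + ∑' k, peanoTerm M (k + 1) t, ?_, fun t => ?_⟩
  · simp [peanoTerm]
  · have key : HasDerivAt (fun z => ∑' k, peanoTerm M (k + 1) z)
        (∑' k, M t * peanoTerm M k t) t := by
      refine hasDerivAt_tsum_of_isPreconnected 
        (g := fun k => peanoTerm M (k + 1)) (g' := fun k y => M y * peanoTerm M k y)
        (t := Metric.ball 0 (|t| + 1)) (y₀ := 0) (y := t)
        ((Real.summable_pow_div_factorial (C * (|t| + 1))).mul_left (C * ‖(1 : 𝔸)‖))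
        Metric.isOpen_ball (convex_ball _ _).isPreconnected
        (fun k y _ => hasDerivAt_peanoTerm_succ hM k y) (fun k y hy => ?_)
        (Metric.mem_ball_self (by positivity)) ((summable_nat_add_iff 1).2 (hsum 0)) (by simp [Metric.mem_ball])
      rw [mul_assoc]
      refine (norm_mul_le _ _).trans (mul_le_mul (hC y) ((norm_peanoTerm_le hC k y).trans ?_)
        (norm_nonneg _) hC0)
      have : |y| ≤ |t| + 1 := by simpa using (Metric.mem_ball.1 hy).le
      gcongr
    have h0 : (1 : 𝔸) + ∑' k, peanoTerm M (k + 1) t = ∑' k, peanoTerm M k t := by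
      rw [(hsum t).tsum_eq_zero_add]; rfl
    simp only [h0]
    rw [← (hsum t).tsum_mul_left]
    exact key.const_add 1

end PeanoSeries

section Transition

open scoped Matrix.Norms.Operator

variable {n : ℕ}

/-- Freezing `M` outside `[0,T]` makes it continuous and bounded on the whole line, so the Peano
series converges for all times. -/
theorem exists_hasMatrixDerivWithinAt_mul {M : ℝ → Matrix (Fin n) (Fin n) ℝ} {T : ℝ} (hT : 0 ≤ T)
    (hM : ContinuousOn M (Icc 0 T)) :
    ∃ Φ : ℝ → Matrix (Fin n) (Fin n) ℝ, Φ 0 = 1 ∧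
      ∀ τ, 0 ≤ τ → HasMatrixDerivWithinAt Φ (M (min τ T) * Φ τ) (Ici 0) τ := by
  obtain ⟨C, hC⟩ := (isCompact_Icc.image_of_continuousOn hM).isBounded.exists_norm_le
  obtain ⟨Φ, h0, h⟩ := exists_hasDerivAt_mul (M := fun t => M (projIcc 0 T hT t)) (C := C)
    (hM.domRestrict.comp continuous_projIcc)
    fun t => hC _ ⟨_, (projIcc 0 T hT t).2, rfl⟩
  refine ⟨Φ, h0, fun τ hτ i j => ?_⟩
  have h1 := (h τ).hasDerivWithinAt (s := Ici 0)
  have h2 : (projIcc 0 T hT τ : ℝ) = min τ T := by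
    simp [projIcc, hτ, hT, min_comm]
  rw [h2] at h1
  exact hasDerivWithinAt_pi.1 (hasDerivWithinAt_pi.1 h1 i) j

theorem hasMatrixDerivWithinAt_exp (A : Matrix (Fin n) (Fin n) ℝ) (D : Set ℝ) (τ : ℝ) :
    HasMatrixDerivWithinAt (fun σ => NormedSpace.exp (σ • A)) (A * NormedSpace.exp (τ • A)) D τ :=
  fun i j => hasDerivWithinAt_pi.1 (hasDerivWithinAt_pi.1
    (hasDerivAt_exp_smul_const' (𝕂 := ℝ) A τ).hasDerivWithinAt i) j

/-- Prepares the identity theorem: such a function vanishing on an interval vanishes everywhere. -/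
theorem analyticOnNhd_linearMap_exp (A : Matrix (Fin n) (Fin n) ℝ)
    (L : Matrix (Fin n) (Fin n) ℝ →ₗ[ℝ] ℝ) :
    AnalyticOnNhd ℝ (fun σ : ℝ => L (NormedSpace.exp (σ • A))) univ := by
  intro σ _
  have h1 : AnalyticAt ℝ (NormedSpace.exp : Matrix (Fin n) (Fin n) ℝ → _) (σ • A) :=
    NormedSpace.exp_analytic _
  have h2 : AnalyticAt ℝ (fun σ : ℝ => σ • A) σ := analyticAt_id.smul analyticAt_const
  exact (L.toContinuousLinearMap.analyticAt _).comp (h1.comp_of_eq h2 rfl)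

end Transition

end Impulsive

/-! ### Equivalence of gain conditions and matrix inequalities -/

namespace Impulsive

theorem negDef_iff_quad {ι : Type} [Fintype ι] {M : Matrix ι ι ℝ} :
    NegDef M ↔ M.IsSymm ∧ ∀ v ≠ 0, quad M v < 0 := by
  unfold NegDef
  rw [posDef_iff_quad]
  simp [Matrix.IsSymm, quad_neg]

theorem negSemidef_iff_quad {ι : Type} [Fintype ι] {M : Matrix ι ι ℝ} :
    NegSemidef M ↔ M.IsSymm ∧ ∀ v, quad M v ≤ 0 := by
  unfold NegSemidef
  rw [posSemidef_iff_quad]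
  simp [Matrix.IsSymm, quad_neg]

theorem isSymm_he {p : ℕ} (M : Matrix (Fin p) (Fin p) ℝ) : (He M).IsSymm := by
  simp [He, Matrix.IsSymm, add_comm]

variable {n mc md : ℕ} {A J : Matrix (Fin n) (Fin n) ℝ} {Bc : Matrix (Fin n) (Fin mc) ℝ}
  {Bd : Matrix (Fin n) (Fin md) ℝ} {T : ℝ} {K : ℝ → Matrix (Fin mc) (Fin n) ℝ}
  {Φ : ℝ → Matrix (Fin n) (Fin n) ℝ}

theorem heldGain_eq (T : ℝ) (K : ℝ → Matrix (Fin mc) (Fin n) ℝ) (τ : ℝ) :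
    heldGain T K τ = K (min τ T) := by
  unfold heldGain
  split_ifs with h
  · rw [min_eq_left h.le]
  · rw [min_eq_right (not_lt.1 h)]

theorem continuousOn_closedLoop {D : Set ℝ} (hK : ContinuousOn K D) :
    ContinuousOn (fun τ => A + Bc * K τ) D :=
  continuousOn_const.add ((continuous_const.matrix_mul continuous_id).comp_continuousOn hK)

theorem exists_isTransitionMatrix (hT : 0 ≤ T) (hK : ContinuousOn K (Icc 0 T)) :
    ∃ Φ, IsTransitionMatrix A Bc (heldGain T K) Φ := by
  obtain ⟨Φ, h0, h⟩ := exists_hasMatrixDerivWithinAt_mul hT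
    (continuousOn_closedLoop (A := A) (Bc := Bc) hK)
  exact ⟨Φ, h0, fun τ hτ => by simpa only [heldGain_eq] using h τ hτ⟩

/-- The transition matrix has an inverse, which solves the adjoint equation. -/
theorem IsTransitionMatrix.exists_inverse (hΦ : IsTransitionMatrix A Bc (heldGain T K) Φ)
    (hT : 0 ≤ T) (hK : ContinuousOn K (Icc 0 T)) :
    ∃ Ψ : ℝ → Matrix (Fin n) (Fin n) ℝ, Ψ 0 = 1 ∧
      (∀ τ, 0 ≤ τ →
        HasMatrixDerivWithinAt Ψ (-(Ψ τ * (A + Bc * heldGain T K τ))) (Ici 0) τ) ∧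
      ∀ τ, 0 ≤ τ → Ψ τ * Φ τ = 1 ∧ Φ τ * Ψ τ = 1 := by
  -- `Ψ = Xᵀ` satisfies the adjoint equation, so `Ψ Φ` has zero derivative and stays equal to 1.
  obtain ⟨X, hX0, hX⟩ := exists_hasMatrixDerivWithinAt_mul (M := fun τ => -(A + Bc * K τ)ᵀ) hT
    (continuous_id.matrix_transpose.neg.comp_continuousOn (continuousOn_closedLoop hK))
  have hd : ∀ τ, 0 ≤ τ → HasMatrixDerivWithinAt (fun τ => (X τ)ᵀ)
      (-((X τ)ᵀ * (A + Bc * heldGain T K τ))) (Ici 0) τ := fun τ hτ => by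
    have := (hX τ hτ).transpose
    rwa [Matrix.transpose_mul, Matrix.transpose_neg, Matrix.transpose_transpose, Matrix.mul_neg,
      ← heldGain_eq T K] at this
  refine ⟨fun τ => (X τ)ᵀ, by simp [hX0], hd, fun τ hτ => ?_⟩
  have h1 : (X τ)ᵀ * Φ τ = 1 := by
    have h2 : ∀ σ ∈ Icc 0 τ, HasMatrixDerivWithinAt (fun σ => (X σ)ᵀ * Φ σ) 0 (Icc 0 τ) σ :=
      fun σ hσ => by
        have := ((hd σ hσ.1).mul (hΦ.2 σ hσ.1)).mono (D' := Icc 0 τ) fun _ hx => hx.1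
        rwa [Matrix.neg_mul, Matrix.mul_assoc, neg_add_cancel] at this
    ext i j
    have := eq_of_hasDerivWithinAt_zero hτ fun σ hσ => h2 σ hσ i j
    simpa [hX0, hΦ.1] using this.symm
  exact ⟨h1, mul_eq_one_comm.1 h1⟩

/-- Schur complement with respect to `Y`; the sign of the off-diagonal block is immaterial. -/
theorem negSemidef_jump_iff {X Y : Matrix (Fin n) (Fin n) ℝ} (hY : Y.PosDef)
    (N : Matrix (Fin n) (Fin n) ℝ) (ε : ℝ) :
    NegSemidef (Matrix.fromBlocks (-X + ε • (1 : Matrix (Fin n) (Fin n) ℝ)) N Nᵀ (-Y)) ↔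
      (X - ε • (1 : Matrix (Fin n) (Fin n) ℝ) - N * Y⁻¹ * Nᵀ).PosSemidef := by
  let := hY.isUnit.invertible
  have h := Matrix.PosDef.fromBlocks₂₂ (X - ε • (1 : Matrix (Fin n) (Fin n) ℝ)) (-N) hY
  rw [Matrix.conjTranspose_eq_transpose_of_trivial, Matrix.neg_mul, Matrix.neg_mul,
    Matrix.transpose_neg, Matrix.mul_neg, neg_neg] at h
  rw [← h, NegSemidef, Matrix.fromBlocks_neg, neg_neg, neg_add, neg_neg, sub_eq_add_neg]

/-- Congruence by the symmetric matrix `S`. -/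
theorem negDef_he_mul_iff {S : Matrix (Fin n) (Fin n) ℝ} (hS : S.PosDef)
    (M : Matrix (Fin n) (Fin n) ℝ) :
    NegDef (He (M * S)) ↔ NegDef (Mᵀ * S⁻¹ + S⁻¹ * M) := by
  have hs : Sᵀ = S := (posDef_iff_quad.1 hS).1
  let := hS.isUnit.invertible
  unfold NegDef
  rw [← Matrix.IsUnit.posDef_star_left_conjugate_iff hS.isUnit (x := -(Mᵀ * S⁻¹ + S⁻¹ * M))]
  have : -He (M * S) = star S * -(Mᵀ * S⁻¹ + S⁻¹ * M) * S := by
    rw [Matrix.star_eq_conjTranspose, Matrix.conjTranspose_eq_transpose_of_trivial, hs]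
    simp only [He, Matrix.transpose_mul, hs, mul_neg, neg_mul, mul_add, add_mul, mul_assoc,
      Matrix.inv_mul_of_invertible, mul_one]
    rw [← mul_assoc S S⁻¹, Matrix.mul_inv_of_invertible, one_mul, add_comm]
  rw [this]

/-- Conversion of a feedback design into a solution of the linear matrix inequalities. -/
theorem DwellTimeConditions.exists_lmis {P : Matrix (Fin n) (Fin n) ℝ}
    {Kd : Matrix (Fin md) (Fin n) ℝ} (hT : 0 ≤ T) (h : DwellTimeConditions A J Bc Bd T P Kd K) :
    ∃ S Uc Ud ε, DwellTimeLMIs A J Bc Bd T S Uc Ud ε := by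
  obtain ⟨Φ, hΦ, hjump⟩ := h.jump
  obtain ⟨Ψ, -, -, hinv⟩ := hΦ.exists_inverse hT h.continuousOn
  have hPi := h.posDef.inv
  let := h.posDef.isUnit.invertible
  have hPs : P⁻¹ᵀ = P⁻¹ := (posDef_iff_quad.1 hPi).1
  obtain ⟨hi1, hi2⟩ := hinv T hT
  have hi4 : (Ψ T)ᵀ * (Φ T)ᵀ = 1 := by rw [← Matrix.transpose_mul, hi2, Matrix.transpose_one]
  -- The initial value for which `Φ R Φᵀ` reaches `P⁻¹` at time `T`.
  set R := Ψ T * P⁻¹ * (Ψ T)ᵀ with hR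
  have hRs : Rᵀ = R := by simp [hR, Matrix.transpose_mul, hPs, mul_assoc]
  have hRi : R⁻¹ = (Φ T)ᵀ * P * Φ T := by
    refine Matrix.inv_eq_right_inv ?_
    calc R * ((Φ T)ᵀ * P * Φ T) = Ψ T * (P⁻¹ * ((Ψ T)ᵀ * (Φ T)ᵀ) * P) * Φ T := by
          simp only [hR, mul_assoc]
      _ = 1 := by rw [hi4, mul_one, Matrix.inv_mul_of_invertible, mul_one, hi1]
  have hRp : R.PosDef := by
    have := (Matrix.IsUnit.posDef_star_right_conjugate_iff (U := Ψ T) (x := P⁻¹)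
      (IsUnit.of_mul_eq_one _ hi1)).2 hPi
    rwa [Matrix.star_eq_conjTranspose, Matrix.conjTranspose_eq_transpose_of_trivial] at this
  set S : ℝ → Matrix (Fin n) (Fin n) ℝ := fun τ => Φ τ * R * (Φ τ)ᵀ with hS
  have hST : S T = P⁻¹ := by
    calc S T = (Φ T * Ψ T) * P⁻¹ * ((Ψ T)ᵀ * (Φ T)ᵀ) := by simp only [hS, hR, mul_assoc]
      _ = P⁻¹ := by rw [hi2, hi4, one_mul, mul_one]
  have hS0 : S 0 = R := by simp [hS, hΦ.1]
  have hSs : ∀ τ, (S τ)ᵀ = S τ := fun τ => by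
    simp [hS, Matrix.transpose_mul, hRs, mul_assoc]
  have hN : J * S T + Bd * (Kd * S T) = (J + Bd * Kd) * P⁻¹ := by
    rw [hST, add_mul, Matrix.mul_assoc]
  -- As `R⁻¹ = Φ(T)ᵀ P Φ(T)`, the jump condition is exactly the other Schur complement.
  have hdef : (R - (J + Bd * Kd) * P⁻¹ * (J + Bd * Kd)ᵀ).PosDef := by
    refine posDef_schur_swap hRp h.posDef _ ?_
    rw [hRi]
    simpa only [NegDef, neg_sub, mul_assoc] using hjump
  obtain ⟨ε, hε, hε'⟩ := exists_posSemidef_sub_smul_one hdef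
  refine ⟨S, fun τ => K τ * S τ, Kd * S T, ε, ?_⟩
  have hHe : ∀ τ, A * S τ + Bc * (K τ * S τ) = (A + Bc * K τ) * S τ := fun τ => by
    rw [add_mul, Matrix.mul_assoc]
  have hderiv : ∀ τ ∈ Icc 0 T, HasMatrixDerivWithinAt S (He ((A + Bc * K τ) * S τ))
      (Icc 0 T) τ := fun τ hτ => by
    have hΦτ := (hΦ.2 τ hτ.1).mono (D' := Icc 0 T) fun _ hx => hx.1
    rw [heldGain_eq, min_eq_left hτ.2] at hΦτ
    have := (hΦτ.mul (.const R)).mul hΦτ.transpose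
    convert! this using 1
    simp only [He, hS, Matrix.transpose_mul, hRs, mul_assoc, mul_zero, add_zero,
      Matrix.transpose_transpose]
  refine ⟨fun τ _ => hSs τ, hST ▸ hPi, ?_, hε, ?_, ⟨fun τ => He ((A + Bc * K τ) * S τ),
    fun τ hτ => ⟨hderiv τ hτ, ?_⟩⟩, ?_⟩
  · have : Continuous fun p : Matrix (Fin mc) (Fin n) ℝ × Matrix (Fin n) (Fin n) ℝ => p.1 * p.2 :=
      continuous_fst.matrix_mul continuous_snd
    exact this.comp_continuousOn (h.continuousOn.prodMk fun τ hτ =>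
      (hderiv τ hτ).continuousWithinAt)
  · rw [hHe, negDef_he_mul_iff (hST ▸ hPi), hST, Matrix.inv_inv_of_invertible]
    exact h.flow
  · rw [hHe, sub_self, NegSemidef, neg_zero]
    exact Matrix.PosSemidef.zero
  · rw [negSemidef_jump_iff (hST ▸ hPi), hN, hS0, hST]
    have : (J + Bd * Kd) * P⁻¹ * P⁻¹⁻¹ * ((J + Bd * Kd) * P⁻¹)ᵀ
        = (J + Bd * Kd) * P⁻¹ * (J + Bd * Kd)ᵀ := by
      rw [Matrix.inv_inv_of_invertible, Matrix.transpose_mul, hPs, ← mul_assoc,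
        mul_assoc _ P⁻¹ P, Matrix.inv_mul_of_invertible, mul_one]
    rw [this]
    convert! hε' using 1
    abel

theorem continuousOn_matrix_inv {S : ℝ → Matrix (Fin n) (Fin n) ℝ} {D : Set ℝ}
    (hS : ContinuousOn S D) (hu : ∀ τ ∈ D, IsUnit (S τ)) : ContinuousOn (fun τ => (S τ)⁻¹) D := by
  have h1 : ContinuousOn (fun τ => (S τ).det) D :=
    continuous_id.matrix_det.comp_continuousOn hS
  have h2 : ContinuousOn (fun τ => (S τ).adjugate) D :=
    continuous_id.matrix_adjugate.comp_continuousOn hS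
  simp only [Matrix.inv_def, Ring.inverse_eq_inv']
  exact (h1.inv₀ fun τ hτ => ((Matrix.isUnit_iff_isUnit_det _).1 (hu τ hτ)).ne_zero).smul h2

/-- Gains retrieved from a solution of the linear matrix inequalities with invertible `S`. -/
theorem DwellTimeLMIs.exists_conditions {S : ℝ → Matrix (Fin n) (Fin n) ℝ}
    {Uc : ℝ → Matrix (Fin mc) (Fin n) ℝ} {Ud : Matrix (Fin md) (Fin n) ℝ} {ε : ℝ} (hT : 0 ≤ T)
    (h : DwellTimeLMIs A J Bc Bd T S Uc Ud ε) (hu : ∀ τ ∈ Icc 0 T, IsUnit (S τ)) :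
    DwellTimeConditions A J Bc Bd T (S T)⁻¹ (Ud * (S T)⁻¹) (fun τ => Uc τ * (S τ)⁻¹) := by
  obtain ⟨S', hS'⟩ := h.flow
  have hTm : T ∈ Icc 0 T := right_mem_Icc.2 hT
  have hK : ∀ τ ∈ Icc 0 T, Uc τ * (S τ)⁻¹ * S τ = Uc τ := fun τ hτ => by
    let := (hu τ hτ).invertible
    rw [Matrix.mul_assoc, Matrix.inv_mul_of_invertible, Matrix.mul_one]
  have hM : ∀ τ ∈ Icc 0 T, (A + Bc * (Uc τ * (S τ)⁻¹)) * S τ = A * S τ + Bc * Uc τ :=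
    fun τ hτ => by rw [add_mul, Matrix.mul_assoc, hK τ hτ]
  have hcont : ContinuousOn (fun τ => Uc τ * (S τ)⁻¹) (Icc 0 T) := by
    have : Continuous fun p : Matrix (Fin mc) (Fin n) ℝ × Matrix (Fin n) (Fin n) ℝ => p.1 * p.2 :=
      continuous_fst.matrix_mul continuous_snd
    exact this.comp_continuousOn (h.continuousOn.prodMk (continuousOn_matrix_inv
      (fun τ hτ => (hS' τ hτ).1.continuousWithinAt) hu))
  obtain ⟨Φ, hΦ⟩ := exists_isTransitionMatrix (A := A) (Bc := Bc) hT hcont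
  obtain ⟨Ψ, hΨ0, hΨ, hinv⟩ := hΦ.exists_inverse hT hcont
  obtain ⟨hi1, hi2⟩ := hinv T hT
  have hSs : (S T)ᵀ = S T := h.symm T hTm
  let := h.posDef.isUnit.invertible
  refine ⟨h.posDef.inv, hcont, ?_, Φ, hΦ, ?_⟩
  · rw [← negDef_he_mul_iff h.posDef, hM T hTm]
    exact h.terminal
  · set W := Ψ T * S T * (Ψ T)ᵀ with hW
    have hWp : W.PosDef := by
      have := (Matrix.IsUnit.posDef_star_right_conjugate_iff (U := Ψ T) (x := S T)
        (IsUnit.of_mul_eq_one _ hi1)).2 h.posDef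
      rwa [Matrix.star_eq_conjTranspose, Matrix.conjTranspose_eq_transpose_of_trivial] at this
    have hi4 : (Ψ T)ᵀ * (Φ T)ᵀ = 1 := by
      rw [← Matrix.transpose_mul, hi2, Matrix.transpose_one]
    have hWi : W⁻¹ = (Φ T)ᵀ * (S T)⁻¹ * Φ T := by
      refine Matrix.inv_eq_right_inv ?_
      calc W * ((Φ T)ᵀ * (S T)⁻¹ * Φ T)
          = Ψ T * (S T * ((Ψ T)ᵀ * (Φ T)ᵀ) * (S T)⁻¹) * Φ T := by simp only [hW, mul_assoc]
        _ = 1 := by rw [hi4, mul_one, Matrix.mul_inv_of_invertible, mul_one, hi1]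
    -- `Ψ S Ψᵀ` has derivative `Ψ (S' - He(A S + Bc Uc)) Ψᵀ ⪰ 0`; compare its values at `0` and `T`.
    have hmono : ∀ v, quad (S 0) v ≤ quad W v := fun v => by
      have hd : ∀ τ ∈ Icc 0 T, HasDerivWithinAt (fun τ => quad (Ψ τ * S τ * (Ψ τ)ᵀ) v)
          (quad (S' τ - He (A * S τ + Bc * Uc τ)) ((Ψ τ)ᵀ *ᵥ v)) (Icc 0 T) τ := fun τ hτ => by
        have hΨτ := (hΨ τ hτ.1).mono (D' := Icc 0 T) fun _ hx => hx.1
        rw [heldGain_eq, min_eq_left hτ.2] at hΨτ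
        have h1 := ((hΨτ.mul (hS' τ hτ).1).mul hΨτ.transpose).quad v
        rw [← quad_congr', ← hM τ hτ]
        convert! h1 using 2
        have hSτ : (S τ)ᵀ = S τ := h.symm τ hτ
        simp only [He, Matrix.transpose_mul, Matrix.transpose_neg, hSτ]
        noncomm_ring
      have := le_of_hasDerivWithinAt_nonneg hT hd fun τ hτ => by
        have := (negSemidef_iff_quad.1 (hS' τ hτ).2).2 ((Ψ τ)ᵀ *ᵥ v)
        rw [quad_sub] at this ⊢
        linarith
      simpa [hΨ0] using this
    set N := J + Bd * (Ud * (S T)⁻¹) with hN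
    have hNS : J * S T + Bd * Ud = N * S T := by
      rw [hN, add_mul, Matrix.mul_assoc, Matrix.mul_assoc, Matrix.inv_mul_of_invertible,
        Matrix.mul_one]
    have hj := h.jump
    rw [negSemidef_jump_iff h.posDef, hNS] at hj
    have hj2 : N * S T * (S T)⁻¹ * (N * S T)ᵀ = N * S T * Nᵀ := by
      rw [mul_assoc N, Matrix.mul_inv_of_invertible, mul_one, Matrix.transpose_mul, hSs, mul_assoc]
    rw [hj2] at hj
    have hpos : (W - N * S T * Nᵀ).PosDef := by
      refine posDef_iff_quad.2 ⟨?_, fun v hv => ?_⟩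
      · simp [Matrix.IsSymm, hW, Matrix.transpose_mul, hSs, mul_assoc]
      · have h1 := (posSemidef_iff_quad.1 hj).2 v
        have h2 := (posDef_iff_quad.1 (Matrix.PosDef.one (n := Fin n) (R := ℝ))).2 v hv
        have h3 := mul_pos h.eps_pos h2
        rw [quad_sub, quad_sub, quad_matrix_smul] at h1
        rw [quad_sub]
        linarith [hmono v]
    have hfin := posDef_schur_swap (X := (S T)⁻¹) (Y := W) h.posDef.inv hWp Nᵀ
      (by simpa using hpos)
    rw [hWi, Matrix.transpose_transpose] at hfin
    simpa only [NegDef, neg_sub, mul_assoc] using hfin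

end Impulsive

/-! ### The controllability Gramian and invertibility of `S` -/

namespace Impulsive

variable {n mc md : ℕ} {A J : Matrix (Fin n) (Fin n) ℝ} {Bc : Matrix (Fin n) (Fin mc) ℝ}
  {Bd : Matrix (Fin n) (Fin md) ℝ} {T : ℝ}

section Gramian

/-- The input matrix in the coordinates `exp (-τ A) x`. -/
noncomputable def rotatedInput (A : Matrix (Fin n) (Fin n) ℝ) (B : Matrix (Fin n) (Fin mc) ℝ)
    (τ : ℝ) : Matrix (Fin n) (Fin mc) ℝ :=
  NormedSpace.exp (τ • -A) * B

/-- The controllability Gramian `∫_τ^T exp (-σ A) B Bᵀ exp (-σ Aᵀ) dσ`. -/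
noncomputable def gramian (A : Matrix (Fin n) (Fin n) ℝ) (B : Matrix (Fin n) (Fin mc) ℝ)
    (T τ : ℝ) : Matrix (Fin n) (Fin n) ℝ :=
  fun i j => ∫ σ in T..τ, -(rotatedInput A B σ * (rotatedInput A B σ)ᵀ) i j

variable (A) (B : Matrix (Fin n) (Fin mc) ℝ)

theorem exp_mul_exp_neg (τ : ℝ) :
    NormedSpace.exp (τ • A) * NormedSpace.exp (τ • -A) = 1 := by
  rw [← Matrix.exp_add_of_commute _ _ (by rw [smul_neg]; exact (Commute.refl _).neg_right),
    smul_neg, add_neg_cancel, NormedSpace.exp_zero]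

theorem continuous_rotatedInput : Continuous (rotatedInput A B) := by
  have : Continuous fun τ : ℝ => NormedSpace.exp (τ • -A) :=
    continuous_iff_continuousAt.2 fun τ => continuousWithinAt_univ _ _ |>.1
      (hasMatrixDerivWithinAt_exp (-A) univ τ).continuousWithinAt
  exact this.matrix_mul continuous_const

theorem hasMatrixDerivWithinAt_gramian (T : ℝ) (D : Set ℝ) (τ : ℝ) :
    HasMatrixDerivWithinAt (gramian A B T)
      (-(rotatedInput A B τ * (rotatedInput A B τ)ᵀ)) D τ := by
  intro i j
  have h : Continuous fun σ => -(rotatedInput A B σ * (rotatedInput A B σ)ᵀ) i j :=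
    (((continuous_rotatedInput A B).matrix_mul
      (continuous_rotatedInput A B).matrix_transpose).matrix_elem i j).neg
  exact (h.integral_hasStrictDerivAt T τ).hasDerivAt.hasDerivWithinAt

theorem gramian_self (T : ℝ) : gramian A B T T = 0 := by
  ext i j
  simp [gramian]

theorem gramian_isSymm (T τ : ℝ) : (gramian A B T τ)ᵀ = gramian A B T τ := by
  ext i j
  simp only [Matrix.transpose_apply, gramian]
  congr 1
  ext σ
  rw [← Matrix.transpose_apply (rotatedInput A B σ * _), Matrix.transpose_mul,
    Matrix.transpose_transpose]

theorem quad_gramian_anti {T σ τ : ℝ} (h : σ ≤ τ) (v : Fin n → ℝ) :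
    quad (gramian A B T τ) v ≤ quad (gramian A B T σ) v := by
  have := le_of_hasDerivWithinAt_nonneg h (fun ξ _ =>
    ((hasMatrixDerivWithinAt_gramian A B T (Icc σ τ) ξ).quad v).neg) fun ξ _ => by
      rw [quad_neg, neg_neg, quad_mul_transpose]
      exact dotProduct_self_star_nonneg _
  simpa using this

theorem quad_gramian_nonneg {T τ : ℝ} (h : τ ≤ T) (v : Fin n → ℝ) :
    0 ≤ quad (gramian A B T τ) v := by
  simpa [gramian_self, quad_zero] using quad_gramian_anti A B (T := T) h v

/-- The Gramian form decreases to 0 at `T`, so if it vanishes at `τ` it vanishes on `[τ,T]`, and so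
does its integrand. Analyticity extends this to all times, notably to those before `τ`. -/
theorem rotatedInput_transpose_mulVec_eq_zero {T τ : ℝ} (h : τ < T) {v : Fin n → ℝ}
    (hv : quad (gramian A B T τ) v = 0) (σ : ℝ) : (rotatedInput A B σ)ᵀ *ᵥ v = 0 := by
  have h0 : ∀ σ ∈ Icc τ T, quad (gramian A B T σ) v = 0 := fun σ hσ =>
    le_antisymm (hv ▸ quad_gramian_anti A B hσ.1 v) (quad_gramian_nonneg A B hσ.2 v)
  have h1 : ∀ σ ∈ Ioo τ T, (rotatedInput A B σ)ᵀ *ᵥ v = 0 := fun σ hσ => by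
    have hd := ((hasMatrixDerivWithinAt_gramian A B T univ σ).quad v).hasDerivAt univ_mem
    have hd0 : HasDerivAt (fun σ => quad (gramian A B T σ) v) 0 σ :=
      (hasDerivAt_const σ (0 : ℝ)).congr_of_eventuallyEq <| by
        filter_upwards [Icc_mem_nhds hσ.1 hσ.2] with ξ hξ using h0 ξ hξ
    have := hd.unique hd0
    rw [quad_neg, neg_eq_zero, quad_mul_transpose, dotProduct_self_eq_zero] at this
    exact this
  ext i
  let L : Matrix (Fin n) (Fin n) ℝ →ₗ[ℝ] ℝ :=
    { toFun := fun X => ((X * B)ᵀ *ᵥ v) i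
      map_add' := fun X Y => by
        rw [Matrix.add_mul, Matrix.transpose_add, Matrix.add_mulVec, Pi.add_apply]
      map_smul' := fun c X => by
        rw [Matrix.smul_mul, Matrix.transpose_smul, Matrix.smul_mulVec]; rfl }
  obtain ⟨ξ, hξ⟩ := nonempty_Ioo.2 h
  have := (analyticOnNhd_linearMap_exp (-A) L).eq_of_eventuallyEq
    (g := fun _ => 0) (fun _ _ => analyticAt_const) (z₀ := ξ) (by
      filter_upwards [Ioo_mem_nhds hξ.1 hξ.2] with σ hσ
      exact congrFun (h1 σ hσ) i)
  exact congrFun this σ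

end Gramian

/-- A solution of the linear matrix inequalities can be made invertible by adding a large
multiple of the controllability Gramian. -/
theorem DwellTimeLMIs.exists_isUnit {S : ℝ → Matrix (Fin n) (Fin n) ℝ}
    {Uc : ℝ → Matrix (Fin mc) (Fin n) ℝ} {Ud : Matrix (Fin md) (Fin n) ℝ} {ε : ℝ} (hT : 0 ≤ T)
    (h : DwellTimeLMIs A J Bc Bd T S Uc Ud ε) :
    ∃ S₁ Uc₁, DwellTimeLMIs A J Bc Bd T S₁ Uc₁ Ud ε ∧ ∀ τ ∈ Icc 0 T, IsUnit (S₁ τ) := by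
  obtain ⟨S', hS'⟩ := h.flow
  set E : ℝ → Matrix (Fin n) (Fin n) ℝ := fun τ => NormedSpace.exp (τ • A) with hE
  set E' : ℝ → Matrix (Fin n) (Fin n) ℝ := fun τ => NormedSpace.exp (τ • -A) with hE'
  set W := gramian A Bc T with hW
  have hEE' : ∀ τ, E τ * E' τ = 1 := exp_mul_exp_neg A
  have hE'E : ∀ τ, E' τ * E τ = 1 := fun τ => mul_eq_one_comm.1 (hEE' τ)
  have hE0 : E 0 = 1 := by simp [hE]
  have hE'0 : E' 0 = 1 := by simp [hE']
  have hcomm : ∀ τ, A * E' τ = E' τ * A := fun τ =>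
    ((((Commute.refl A).neg_right).smul_right τ).exp_right).eq
  have hdE' : ∀ τ D, HasMatrixDerivWithinAt E' (-(E' τ * A)) D τ := fun τ D => by
    have := hasMatrixDerivWithinAt_exp (-A) D τ
    rwa [neg_mul, hcomm τ] at this
  have hdF : ∀ τ ∈ Icc 0 T, HasMatrixDerivWithinAt (fun τ => E' τ * S τ * (E' τ)ᵀ)
      (E' τ * (S' τ - He (A * S τ)) * (E' τ)ᵀ) (Icc 0 T) τ := fun τ hτ => by
    have := ((hdE' τ _).mul (hS' τ hτ).1).mul (hdE' τ _).transpose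
    convert! this using 1
    have hSτ : (S τ)ᵀ = S τ := h.symm τ hτ
    simp only [He, Matrix.transpose_mul, Matrix.transpose_neg, hSτ]
    noncomm_ring
  have hpos0 : ∀ v ≠ 0, 0 < quad (S 0) v := fun v hv => by
    have h0 := (posSemidef_iff_quad.1 ((negSemidef_jump_iff h.posDef _ ε).1 h.jump)).2 v
    have h1 := mul_pos h.eps_pos
      ((posDef_iff_quad.1 (Matrix.PosDef.one (n := Fin n) (R := ℝ))).2 v hv)
    have h2 := (posSemidef_iff_quad.1 h.posDef.inv.posSemidef).2
      ((J * S T + Bd * Ud)ᵀ *ᵥ v)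
    rw [quad_sub, quad_sub, quad_matrix_smul, quad_congr'] at h0
    linarith
  have hinj : ∀ τ v, v ≠ 0 → (E' τ)ᵀ *ᵥ v ≠ 0 := fun τ v hv h0 => hv <| by
    have : (E τ)ᵀ *ᵥ ((E' τ)ᵀ *ᵥ v) = v := by
      rw [Matrix.mulVec_mulVec, ← Matrix.transpose_mul, hE'E, Matrix.transpose_one,
        Matrix.one_mulVec]
    rw [← this, h0, Matrix.mulVec_zero]
  -- At `τ = T` the Gramian is zero and `S(T) ≻ 0` is needed. Before `T`, the term `Bc Uc`
  -- disappears on `v` for all `σ ≤ τ`, so the form is nondecreasing from `S(0)`.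
  have hker : ∀ τ ∈ Icc 0 T, ∀ v ≠ 0, quad (W τ) v = 0 →
      0 < quad (E' τ * S τ * (E' τ)ᵀ) v := fun τ hτ v hv h0 => by
    rcases hτ.2.eq_or_lt with rfl | hlt
    · rw [quad_congr']
      exact (posDef_iff_quad.1 h.posDef).2 _ (hinj _ _ hv)
    · have hz := rotatedInput_transpose_mulVec_eq_zero A Bc hlt h0
      have hsub : Icc 0 τ ⊆ Icc 0 T := Icc_subset_Icc_right hτ.2
      have := le_of_hasDerivWithinAt_nonneg hτ.1
        (fun σ hσ => ((hdF σ (hsub hσ)).mono hsub).quad v) fun σ hσ => by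
          have h1 := (negSemidef_iff_quad.1 (hS' σ (hsub hσ)).2).2 ((E' σ)ᵀ *ᵥ v)
          have h2 : Bcᵀ *ᵥ ((E' σ)ᵀ *ᵥ v) = 0 := by
            rw [Matrix.mulVec_mulVec, ← Matrix.transpose_mul]
            exact hz σ
          have h3 : quad (Bc * Uc σ) ((E' σ)ᵀ *ᵥ v) = 0 := by
            unfold quad
            rw [← Matrix.mulVec_mulVec, Matrix.dotProduct_mulVec, ← Matrix.mulVec_transpose, h2,
              zero_dotProduct]
          rw [quad_congr', quad_sub]
          simp only [He, quad_sub, quad_add, quad_transpose, h3] at h1 ⊢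
          linarith
      refine lt_of_lt_of_le ?_ this
      simpa [hE'0] using hpos0 v hv
  obtain ⟨c, hc, hcpos⟩ := exists_quad_add_smul_pos isCompact_Icc
    (fun τ hτ => (hdF τ hτ).continuousWithinAt)
    (fun τ _ => (hasMatrixDerivWithinAt_gramian A Bc T _ τ).continuousWithinAt)
    (fun τ hτ v => quad_gramian_nonneg A Bc hτ.2 v) hker
  have hWs : ∀ τ, (W τ)ᵀ = W τ := gramian_isSymm A Bc T
  have hWT : W T = 0 := gramian_self A Bc T
  have hEB : ∀ τ, E τ * (rotatedInput A Bc τ * (rotatedInput A Bc τ)ᵀ) * (E τ)ᵀ = Bc * Bcᵀ :=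
    fun τ => by
      have : E τ * rotatedInput A Bc τ = Bc := by
        rw [rotatedInput, ← Matrix.mul_assoc, exp_mul_exp_neg, Matrix.one_mul]
      rw [← Matrix.mul_assoc (E τ), this, Matrix.mul_assoc, ← Matrix.transpose_mul, this]
  set S₁ : ℝ → Matrix (Fin n) (Fin n) ℝ := fun τ => S τ + c • (E τ * W τ * (E τ)ᵀ) with hS₁
  have hS₁T : S₁ T = S T := by simp [hS₁, hWT]
  have hS₁s : ∀ τ ∈ Icc 0 T, (S₁ τ)ᵀ = S₁ τ := fun τ hτ => by
    have hSτ : (S τ)ᵀ = S τ := h.symm τ hτ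
    simp [hS₁, Matrix.transpose_mul, hWs, hSτ, mul_assoc]
  have hBB : ∀ τ, Bc * (Uc τ - (c / 2) • Bcᵀ) = Bc * Uc τ - (c / 2) • (Bc * Bcᵀ) := fun τ => by
    rw [Matrix.mul_sub, Matrix.mul_smul]
  have hHB : He (Bc * Bcᵀ) = (2 : ℝ) • (Bc * Bcᵀ) := by
    rw [He, Matrix.transpose_mul, Matrix.transpose_transpose, two_smul]
  -- The shift of `Uc` by `-(c/2) Bcᵀ` contributes `-c Bc Bcᵀ` to `He`, matching the derivative of
  -- the added Gramian term.
  refine ⟨S₁, fun τ => Uc τ - (c / 2) • Bcᵀ, ⟨hS₁s, hS₁T ▸ h.posDef,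
    h.continuousOn.sub continuousOn_const, h.eps_pos, ?_,
    ⟨fun τ => S' τ + c • (He (A * (E τ * W τ * (E τ)ᵀ)) - Bc * Bcᵀ), fun τ hτ => ⟨?_, ?_⟩⟩, ?_⟩,
    fun τ hτ => ?_⟩
  · refine negDef_iff_quad.2 ⟨isSymm_he _, fun v hv => ?_⟩
    have h1 := (negDef_iff_quad.1 h.terminal).2 v hv
    have h2 : 0 ≤ quad (Bc * Bcᵀ) v := by
      rw [quad_mul_transpose]; exact dotProduct_self_star_nonneg _
    rw [hBB, hS₁T]
    simp only [He, quad_add, quad_transpose, quad_sub, quad_matrix_smul] at h1 ⊢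
    nlinarith [mul_nonneg hc.le h2]
  · have hdE := hasMatrixDerivWithinAt_exp A (Icc 0 T) τ
    have := (hS' τ hτ).1.add (((hdE.mul (hasMatrixDerivWithinAt_gramian A Bc T _ τ)).mul
      hdE.transpose).const_smul c)
    convert! this using 3
    rw [← hEB τ]
    simp only [He, Matrix.transpose_mul, Matrix.transpose_transpose, hWs, ← hW, hE]
    noncomm_ring
  · have := (hS' τ hτ).2
    convert! this using 1
    rw [hBB]
    have h2 : He (A * S₁ τ + (Bc * Uc τ - (c / 2) • (Bc * Bcᵀ))) =
        He (A * S τ + Bc * Uc τ) + c • He (A * (E τ * W τ * (E τ)ᵀ))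
          - (c / 2) • He (Bc * Bcᵀ) := by
      simp only [He, hS₁, Matrix.mul_add, Matrix.transpose_add, Matrix.transpose_sub,
        Matrix.transpose_smul, Matrix.mul_smul, smul_add]
      abel
    rw [h2, hHB, smul_smul, div_mul_cancel₀ _ two_ne_zero]
    simp only [smul_sub]
    abel
  · have h1 := (negSemidef_jump_iff h.posDef _ ε).1 h.jump
    rw [hS₁T, negSemidef_jump_iff h.posDef]
    have h2 : (c • W 0).PosSemidef :=
      (posSemidef_iff_quad.2 ⟨hWs 0, quad_gramian_nonneg A Bc hT⟩).smul hc.le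
    convert! h1.add h2 using 1
    simp only [hS₁, hE0, Matrix.transpose_one, one_mul, mul_one]
    abel
  · refine (posDef_iff_quad.2 ⟨hS₁s τ hτ, fun v hv => ?_⟩).isUnit
    have hv' : (E τ)ᵀ *ᵥ v ≠ 0 := fun h0 => hv <| by
      have : (E' τ)ᵀ *ᵥ ((E τ)ᵀ *ᵥ v) = v := by
        rw [Matrix.mulVec_mulVec, ← Matrix.transpose_mul, hEE', Matrix.transpose_one,
          Matrix.one_mulVec]
      rw [← this, h0, Matrix.mulVec_zero]
    have := hcpos τ hτ _ hv'
    rw [← quad_congr'] at this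
    convert! this using 2
    have h1 : (E' τ)ᵀ * (E τ)ᵀ = 1 := by
      rw [← Matrix.transpose_mul, hEE', Matrix.transpose_one]
    calc S₁ τ = (E τ * E' τ) * S τ * ((E' τ)ᵀ * (E τ)ᵀ) + c • (E τ * W τ * (E τ)ᵀ) := by
          rw [hEE', h1, one_mul, mul_one]
      _ = _ := by noncomm_ring

end Impulsive

namespace Impulsive

variable {n mc md : ℕ} {A J : Matrix (Fin n) (Fin n) ℝ} {Bc : Matrix (Fin n) (Fin mc) ℝ}
  {Bd : Matrix (Fin n) (Fin md) ℝ} {T : ℝ} {Kc : ℝ → Matrix (Fin mc) (Fin n) ℝ}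
  {Kd : Matrix (Fin md) (Fin n) ℝ} {N : ℕ∞} {t : ℕ → ℝ} {s : ℝ} {x : ℝ → Fin n → ℝ}

/-! ### Impulse instants -/

theorem InInterval.of_le {k : ℕ} {u v : ℝ} (h : InInterval N t k v) (hu : t k ≤ u) (huv : u ≤ v) :
    InInterval N t k u :=
  ⟨h.1, hu, fun hk => huv.trans_lt (h.2.2 hk)⟩

theorem HasMinDwellTime.add_mul_le (h : HasMinDwellTime T N t) (k : ℕ) (hk : (k : ℕ∞) ≤ N) :
    t 0 + k * T ≤ t k := by
  induction k with
  | zero => simp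
  | succ k ih =>
    have h1 := ih (le_trans (by exact_mod_cast k.le_succ) hk)
    have h2 := h k hk
    push_cast
    linarith

theorem HasMinDwellTime.le_of_le (h : HasMinDwellTime T N t) (hT : 0 ≤ T) {i k : ℕ} (hik : i ≤ k)
    (hk : (k : ℕ∞) ≤ N) : t i ≤ t k := by
  induction k, hik using Nat.le_induction with
  | base => exact le_rfl
  | succ k _ ih =>
    have h1 := ih (le_trans (by exact_mod_cast k.le_succ) hk)
    linarith [h k hk]

/-- Otherwise all the `t k` would lie before `τ`, which a positive dwell-time forbids. -/
theorem HasMinDwellTime.exists_inInterval (h : HasMinDwellTime T N t) (hT : 0 < T) {τ : ℝ}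
    (hτ : t 0 ≤ τ) : ∃ k, InInterval N t k τ := by
  by_contra! hno
  have key : ∀ k : ℕ, (k : ℕ∞) ≤ N ∧ t k ≤ τ := fun k => by
    induction k with
    | zero => exact ⟨by simp, hτ⟩
    | succ k ih =>
      have := hno k
      simp only [InInterval, ih, true_and] at this
      push Not at this
      exact this
  obtain ⟨k, hk⟩ := exists_nat_gt ((τ - t 0) / T)
  have h1 := h.add_mul_le k (key k).1
  rw [div_lt_iff₀ hT] at hk
  linarith [(key k).2]

theorem HasMinDwellTime.le_index (h : HasMinDwellTime T N t) (hT : 0 ≤ T) {j k : ℕ} {τ : ℝ}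
    (hj : (j : ℕ∞) ≤ N) (hjτ : t j ≤ τ) (hk : InInterval N t k τ) : j ≤ k := by
  by_contra! hlt
  have hk1 : ((k + 1 : ℕ) : ℕ∞) ≤ N := le_trans (by exact_mod_cast hlt) hj
  have h1 := hk.2.2 hk1
  have h2 := h.le_of_le hT (Nat.succ_le_of_lt hlt) hj
  linarith

/-! ### Flow between impulses -/

theorem IsTrajectory.continuousOn (hx : IsTrajectory A J Bc Bd Kc Kd N t s x) {k : ℕ} {u v : ℝ}
    (hv : InInterval N t k v) (hu : t k ≤ u) (hs : s ≤ u) : ContinuousOn x (Icc u v) := by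
  intro τ hτ
  rcases hτ.1.eq_or_lt with rfl | hlt
  · exact (hx.rightCont _ hs).mono Icc_subset_Ici_self
  · exact (hx.flow k τ (hv.of_le (hu.trans hτ.1) hτ.2) (hu.trans_lt hlt)
      (hs.trans_lt hlt)).continuousAt.continuousWithinAt

theorem IsTrajectory.hasDerivAt (hx : IsTrajectory A J Bc Bd Kc Kd N t s x) {k : ℕ} {u v τ : ℝ}
    (hv : InInterval N t k v) (hu : t k ≤ u) (hs : s ≤ u) (hτ : τ ∈ Ioo u v) :
    HasDerivAt x ((A + Bc * Kc (τ - t k)) *ᵥ x τ) τ := by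
  rw [Matrix.add_mulVec, ← Matrix.mulVec_mulVec]
  exact hx.flow k τ (hv.of_le (hu.trans hτ.1.le) hτ.2.le) (hu.trans_lt hτ.1) (hs.trans_lt hτ.1)

/-- Solutions of the adjoint equation cancel the flow. -/
theorem IsTrajectory.adjoint_mulVec_eq (hx : IsTrajectory A J Bc Bd Kc Kd N t s x)
    {Ψ : ℝ → Matrix (Fin n) (Fin n) ℝ}
    (hΨ : ∀ τ, 0 ≤ τ → HasMatrixDerivWithinAt Ψ (-(Ψ τ * (A + Bc * Kc τ))) (Ici 0) τ)
    {k : ℕ} {u v : ℝ} (hu : t k ≤ u) (hs : s ≤ u) (huv : u ≤ v) (hv : InInterval N t k v) :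
    Ψ (u - t k) *ᵥ x u = Ψ (v - t k) *ᵥ x v := by
  have hmaps : MapsTo (fun σ => σ - t k) (Icc u v) (Ici 0) := fun σ hσ =>
    sub_nonneg.2 (hu.trans hσ.1)
  have hΨc : ContinuousOn (fun σ => Ψ (σ - t k)) (Icc u v) :=
    ContinuousOn.comp (t := Ici 0) (fun τ hτ => (hΨ τ hτ).continuousWithinAt)
      (continuous_id.sub continuous_const).continuousOn hmaps
  have hc : ContinuousOn (fun σ => Ψ (σ - t k) *ᵥ x σ) (Icc u v) :=
    (continuous_fst.matrix_mulVec continuous_snd).comp_continuousOn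
      (hΨc.prodMk (hx.continuousOn hv hu hs))
  have hd : ∀ σ ∈ Ioo u v, HasDerivAt (fun σ => Ψ (σ - t k) *ᵥ x σ) 0 σ := fun σ hσ => by
    have hpos : 0 < σ - t k := sub_pos.2 (hu.trans_lt hσ.1)
    have h1 : HasMatrixDerivWithinAt (fun σ => Ψ (σ - t k))
        (-(Ψ (σ - t k) * (A + Bc * Kc (σ - t k)))) univ σ := fun i j =>
      (((hΨ _ hpos.le i j).hasDerivAt (Ici_mem_nhds hpos)).comp_sub_const σ (t k)).hasDerivWithinAt
    have h2 := (h1.mulVec (hx.hasDerivAt hv hu hs hσ).hasDerivWithinAt).hasDerivAt univ_mem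
    rwa [Matrix.neg_mulVec, Matrix.mulVec_mulVec, neg_add_cancel] at h2
  ext i
  exact eq_of_hasDerivAt_zero huv (fun σ hσ => continuousWithinAt_pi.1 (hc σ hσ) i)
    fun σ hσ => hasDerivAt_pi.1 (hd σ hσ) i

theorem hasDerivAt_quad_comp {P M : Matrix (Fin n) (Fin n) ℝ} {τ : ℝ}
    (hx : HasDerivAt x (M *ᵥ x τ) τ) :
    HasDerivAt (fun σ => quad P (x σ)) (quad (Mᵀ * P + P * M) (x τ)) τ := by
  have h1 : HasDerivAt (fun σ => P *ᵥ x σ) (P *ᵥ (M *ᵥ x τ)) τ := by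
    have := ((HasMatrixDerivWithinAt.const (D := univ) (τ := τ) P).mulVec
      hx.hasDerivWithinAt).hasDerivAt univ_mem
    simpa using this
  have h2 : HasDerivAt (fun σ => ∑ i, x σ i * (P *ᵥ x σ) i)
      (∑ i, ((M *ᵥ x τ) i * (P *ᵥ x τ) i + x τ i * (P *ᵥ (M *ᵥ x τ)) i)) τ :=
    HasDerivAt.fun_sum fun i _ => (hasDerivAt_pi.1 hx i).mul (hasDerivAt_pi.1 h1 i)
  convert! h2 using 1
  rw [Finset.sum_add_distrib, quad_add]
  unfold quad
  rw [← Matrix.mulVec_mulVec, ← Matrix.mulVec_mulVec, Matrix.dotProduct_mulVec,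
    Matrix.vecMul_transpose]
  rfl

/-- Exponential decay of a Lyapunov function once the gain is frozen. -/
theorem IsTrajectory.quad_le_exp_mul (hx : IsTrajectory A J Bc Bd Kc Kd N t s x)
    {P M : Matrix (Fin n) (Fin n) ℝ} {α : ℝ} (hM : ∀ τ, T ≤ τ → A + Bc * Kc τ = M)
    (hα : ∀ v, quad (Mᵀ * P + P * M) v ≤ -(α * quad P v)) {k : ℕ} {u v : ℝ} (hT : 0 ≤ T)
    (hu : t k + T ≤ u) (hs : s ≤ u) (huv : u ≤ v) (hv : InInterval N t k v) :
    quad P (x v) ≤ Real.exp (-(α * (v - u))) * quad P (x u) := by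
  have hu' : t k ≤ u := by linarith
  have hexp : ∀ σ, HasDerivAt (fun σ => Real.exp (α * (σ - u)))
      (Real.exp (α * (σ - u)) * (α * 1)) σ := fun σ =>
    (((hasDerivAt_id σ).sub_const u).const_mul α).exp
  have h := le_of_hasDerivAt_nonneg (f := fun σ => -(Real.exp (α * (σ - u)) * quad P (x σ))) huv
    (((by fun_prop : Continuous fun σ => Real.exp (α * (σ - u))).continuousOn.mul
      ((continuous_quad.comp (continuous_const.prodMk continuous_id)).comp_continuousOn
        (hx.continuousOn hv hu' hs))).neg)
    (fun σ hσ => by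
      have h1 := hx.hasDerivAt hv hu' hs hσ
      rw [hM _ (by linarith [hσ.1])] at h1
      exact ((hexp σ).mul (hasDerivAt_quad_comp h1)).neg)
    fun σ _ => by
      have h2 := mul_le_mul_of_nonneg_left (hα (x σ)) (Real.exp_pos (α * (σ - u))).le
      linarith
  simp only [sub_self, mul_zero, Real.exp_zero, one_mul] at h
  rw [Real.exp_neg, ← div_eq_inv_mul, le_div_iff₀ (Real.exp_pos _)]
  linarith

/-! ### Stability -/

/-- A clock-dependent Lyapunov function that does not increase along the flow and contracts by
`ρ` at the impulses. -/
theorem IsTrajectory.quad_le_pow_mul (hx : IsTrajectory A J Bc Bd Kc Kd N t s x)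
    (ht : HasMinDwellTime T N t) (hT : 0 < T) {Q : ℝ → Matrix (Fin n) (Fin n) ℝ} {ρ : ℝ}
    (hρ : 0 ≤ ρ) (hQ : ContinuousOn Q (Ici 0))
    (hflow : ∀ k u v, t k ≤ u → s ≤ u → u ≤ v → InInterval N t k v →
      quad (Q (v - t k)) (x v) ≤ quad (Q (u - t k)) (x u))
    (hjump : ∀ τ, T ≤ τ → ∀ v, quad (Q 0) (J *ᵥ v + Bd *ᵥ (Kd *ᵥ v)) ≤ ρ * quad (Q τ) v)
    {j : ℕ} (hj : InInterval N t j s) (d : ℕ) {τ : ℝ} (hτ : s ≤ τ)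
    (hd : InInterval N t (j + d) τ) :
    quad (Q (τ - t (j + d))) (x τ) ≤ ρ ^ d * quad (Q (s - t j)) (x s) := by
  induction d generalizing τ with
  | zero => simpa using hflow j s τ hj.2.1 le_rfl hτ hd
  | succ d ih =>
    rw [← add_assoc] at hd ⊢
    set k := j + d with hk
    have hkN : ((k + 1 : ℕ) : ℕ∞) ≤ N := hd.1
    have hkN' : (k : ℕ∞) ≤ N := le_trans (by exact_mod_cast k.le_succ) hkN
    have hgap := ht k hkN
    -- Jumps are prescribed only strictly after `s`: a state given at an impulse instant is already
    -- post-jump.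
    have hs1 : s < t (k + 1) := by
      have h1 := hj.2.2 (le_trans (by exact_mod_cast (by omega : j + 1 ≤ k + 1)) hkN)
      exact h1.trans_le (ht.le_of_le hT.le (by omega) hkN)
    obtain ⟨xm, hxm, hxk⟩ := hx.jump (k + 1) hkN hs1
    have hlim : Tendsto (fun σ => quad (Q (σ - t k)) (x σ)) (𝓝[<] t (k + 1))
        (𝓝 (quad (Q (t (k + 1) - t k)) xm)) := by
      have hp : 0 < t (k + 1) - t k := hT.trans_le hgap
      have h1 : Tendsto (fun σ => Q (σ - t k)) (𝓝[<] t (k + 1)) (𝓝 (Q (t (k + 1) - t k))) :=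
        ((hQ.continuousAt (Ici_mem_nhds hp)).tendsto.comp
          ((continuous_id.sub continuous_const).tendsto (t (k + 1)))).mono_left
          nhdsWithin_le_nhds
      exact (continuous_quad.tendsto (Q (t (k + 1) - t k), xm)).comp (h1.prodMk_nhds hxm)
    -- The bound holds just before the impulse and passes to the left limit.
    have hle : quad (Q (t (k + 1) - t k)) xm ≤ ρ ^ d * quad (Q (s - t j)) (x s) := by
      refine le_of_tendsto hlim ?_
      have hlt : max s (t k) < t (k + 1) := max_lt hs1 (by linarith)
      filter_upwards [Ioo_mem_nhdsLT hlt] with σ hσ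
      exact ih ((le_max_left _ _).trans hσ.1.le)
        ⟨hkN', (le_max_right _ _).trans hσ.1.le, fun _ => hσ.2⟩
    calc quad (Q (τ - t (k + 1))) (x τ) ≤ quad (Q (t (k + 1) - t (k + 1))) (x (t (k + 1))) :=
          hflow _ _ _ le_rfl hs1.le hd.2.1 hd
      _ = quad (Q 0) (J *ᵥ xm + Bd *ᵥ (Kd *ᵥ xm)) := by rw [sub_self, hxk]
      _ ≤ ρ * quad (Q (t (k + 1) - t k)) xm := hjump _ hgap xm
      _ ≤ ρ * (ρ ^ d * quad (Q (s - t j)) (x s)) := mul_le_mul_of_nonneg_left hle hρ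
      _ = ρ ^ (d + 1) * quad (Q (s - t j)) (x s) := by ring

theorem DwellTimeConditions.stable {P : Matrix (Fin n) (Fin n) ℝ}
    {K : ℝ → Matrix (Fin mc) (Fin n) ℝ} (hT : 0 < T)
    (h : DwellTimeConditions A J Bc Bd T P Kd K) :
    StableUnderMinDwellTime A J Bc Bd T (heldGain T K) Kd := by
  intro N t ht s hs
  obtain ⟨Φ, hΦ, hjump⟩ := h.jump
  obtain ⟨Ψ, hΨ0, hΨ, hinv⟩ := hΦ.exists_inverse hT.le h.continuousOn
  set R := (Φ T)ᵀ * P * Φ T with hR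
  set Q : ℝ → Matrix (Fin n) (Fin n) ℝ := fun τ => (Ψ (min τ T))ᵀ * R * Ψ (min τ T) with hQdef
  have hQv : ∀ τ v, quad (Q τ) v = quad R (Ψ (min τ T) *ᵥ v) := fun τ v => quad_congr _ _ _
  have hRT : ∀ v, quad R (Ψ T *ᵥ v) = quad P v := fun v => by
    rw [hR, quad_congr, Matrix.mulVec_mulVec, (hinv T hT.le).2, Matrix.one_mulVec]
  have hQT : ∀ τ, T ≤ τ → ∀ v, quad (Q τ) v = quad P v := fun τ hτ v => by
    rw [hQv, min_eq_right hτ, hRT]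
  have hQc : ContinuousOn Q (Ici 0) := by
    have h1 : ContinuousOn (fun τ => Ψ (min τ T)) (Ici 0) :=
      ContinuousOn.comp (t := Ici 0) (fun τ hτ => (hΨ τ hτ).continuousWithinAt)
        (continuous_id.min continuous_const).continuousOn fun τ hτ => le_min hτ hT.le
    have h2 : Continuous fun X : Matrix (Fin n) (Fin n) ℝ => Xᵀ * R * X :=
      (continuous_id.matrix_transpose.matrix_mul continuous_const).matrix_mul continuous_id
    exact h2.comp_continuousOn h1
  have hQpos : ∀ τ, 0 ≤ τ → ∀ v ≠ 0, 0 < quad (Q τ) v := fun τ hτ v hv => by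
    rw [hQv, hR, quad_congr]
    refine (posDef_iff_quad.1 h.posDef).2 _ fun h0 => hv ?_
    have h1 := congrArg (fun w => Φ (min τ T) *ᵥ (Ψ T *ᵥ w)) h0
    simpa only [Matrix.mulVec_mulVec, Matrix.mulVec_zero, ← Matrix.mul_assoc,
      (hinv T hT.le).1, Matrix.one_mul, (hinv _ (le_min hτ hT.le)).2, Matrix.one_mulVec] using h1
  have hQmin : ∀ τ, Q τ = Q (min τ T) := fun τ => by simp [hQdef]
  have hmem : ∀ τ, 0 ≤ τ → min τ T ∈ Icc 0 T := fun τ hτ => ⟨le_min hτ hT.le, min_le_right _ _⟩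
  -- `Q` is frozen after `T`, so bounds on the compact `[0,T]` hold for all clock values.
  obtain ⟨c₁, hc₁, hlow⟩ := exists_le_quad isCompact_Icc (hQc.mono Icc_subset_Ici_self)
    (fun τ (hτ : τ ∈ Icc 0 T) => hQpos τ hτ.1)
  obtain ⟨c₂, hc₂, hup⟩ := exists_quad_le (isCompact_Icc (a := 0) (b := T))
    (hQc.mono Icc_subset_Ici_self)
  obtain ⟨α, hα, hαle⟩ := exists_mul_quad_le h.flow P
  obtain ⟨μ, hμ, hμle⟩ := exists_mul_quad_le hjump P
  have hPnn : ∀ v, 0 ≤ quad P v := (posSemidef_iff_quad.1 h.posDef.posSemidef).2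
  -- The maximum with 0 keeps the powers of `ρ` nonnegative, as `μ` comes with no upper bound.
  set ρ := max 0 (1 - μ) with hρ
  have hρ0 : 0 ≤ ρ := le_max_left _ _
  have hρ1 : ρ < 1 := max_lt one_pos (by linarith)
  have hJ : ∀ τ, T ≤ τ → ∀ v, quad (Q 0) (J *ᵥ v + Bd *ᵥ (Kd *ᵥ v)) ≤ ρ * quad (Q τ) v :=
    fun τ hτ v => by
      have h1 := hμle v
      have h2 : quad ((J + Bd * Kd)ᵀ * (Φ T)ᵀ * P * Φ T * (J + Bd * Kd)) v
          = quad (Q 0) (J *ᵥ v + Bd *ᵥ (Kd *ᵥ v)) := by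
        rw [hQv, min_eq_left hT.le, hΨ0, Matrix.one_mulVec, Matrix.mulVec_mulVec,
          ← Matrix.add_mulVec, ← quad_congr, hR]
        simp only [mul_assoc]
      rw [quad_neg, quad_sub, h2] at h1
      rw [hQT τ hτ]
      have h3 := mul_le_mul_of_nonneg_right (le_max_right 0 (1 - μ)) (hPnn v)
      linarith
  have hM : ∀ τ, T ≤ τ → A + Bc * heldGain T K τ = A + Bc * K T := fun τ hτ => by
    rw [heldGain_eq, min_eq_right hτ]
  have hα' : ∀ v, quad ((A + Bc * K T)ᵀ * P + P * (A + Bc * K T)) v ≤ -(α * quad P v) :=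
    fun v => by
      have := hαle v
      rw [quad_neg] at this
      linarith
  have hF : ∀ x, IsTrajectory A J Bc Bd (heldGain T K) Kd N t s x → ∀ k u v, t k ≤ u → s ≤ u →
      u ≤ v → InInterval N t k v → quad (Q (v - t k)) (x v) ≤ quad (Q (u - t k)) (x u) := by
    intro x hx k u v hu hsu huv hv
    have hearly : ∀ u v, t k ≤ u → s ≤ u → u ≤ v → InInterval N t k v → v ≤ t k + T →
        quad (Q (v - t k)) (x v) = quad (Q (u - t k)) (x u) := fun u v hu hsu huv hv hvT => by
      rw [hQv, hQv, min_eq_left (by linarith), min_eq_left (by linarith),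
        hx.adjoint_mulVec_eq hΨ hu hsu huv hv]
    have hlate : ∀ u v, t k + T ≤ u → s ≤ u → u ≤ v → InInterval N t k v →
        quad (Q (v - t k)) (x v) ≤ quad (Q (u - t k)) (x u) := fun u v hu hsu huv hv => by
      rw [hQT _ (by linarith), hQT _ (by linarith)]
      refine (hx.quad_le_exp_mul hM hα' hT.le hu hsu huv hv).trans
        (mul_le_of_le_one_left (hPnn _) (Real.exp_le_one_iff.2 ?_))
      have := mul_nonneg hα.le (sub_nonneg.2 huv)
      linarith
    rcases le_total v (t k + T) with h1 | h1
    · exact (hearly u v hu hsu huv hv h1).le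
    rcases le_total (t k + T) u with h2 | h2
    · exact hlate u v h2 hsu huv hv
    · exact (hlate _ v le_rfl (hsu.trans h2) h1 hv).trans
        (hearly u _ hu hsu h2 (hv.of_le (hu.trans h2) h1) le_rfl).le
  obtain ⟨j, hj⟩ := ht.exists_inInterval hT hs
  have hbound : ∀ x, IsTrajectory A J Bc Bd (heldGain T K) Kd N t s x → ∀ d τ, s ≤ τ →
      InInterval N t (j + d) τ → c₁ * ‖x τ‖ ^ 2 ≤ ρ ^ d * (c₂ * ‖x s‖ ^ 2) :=
    fun x hx d τ hτ hd => by
      have h1 := hlow _ (hmem (τ - t (j + d)) (sub_nonneg.2 hd.2.1)) (x τ)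
      have h2 := hup _ (hmem (s - t j) (sub_nonneg.2 hj.2.1)) (x s)
      rw [← hQmin] at h1 h2
      refine h1.trans ((hx.quad_le_pow_mul ht hT hρ0 hQc (hF x hx) hJ hj d hτ hd).trans ?_)
      exact mul_le_mul_of_nonneg_left ((le_abs_self _).trans h2) (pow_nonneg hρ0 _)
  have hidx : ∀ τ, s ≤ τ → ∃ d, InInterval N t (j + d) τ := fun τ hτ => by
    obtain ⟨k, hk⟩ := ht.exists_inInterval hT (hs.trans hτ)
    obtain ⟨d, rfl⟩ := Nat.exists_eq_add_of_le (ht.le_index hT.le hj.1 (hj.2.1.trans hτ) hk)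
    exact ⟨d, hk⟩
  refine ⟨fun η hη => ⟨η * √(c₁ / c₂), by positivity, fun x hx hxs τ hτ => ?_⟩, fun x hx => ?_⟩
  · obtain ⟨d, hd⟩ := hidx τ hτ
    have h1 : c₁ * ‖x τ‖ ^ 2 ≤ c₂ * ‖x s‖ ^ 2 := (hbound x hx d τ hτ hd).trans
      (mul_le_of_le_one_left (by positivity) (pow_le_one₀ hρ0 hρ1.le))
    have h2 : ‖x s‖ ^ 2 < (η * √(c₁ / c₂)) ^ 2 := pow_lt_pow_left₀ hxs (norm_nonneg _) two_ne_zero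
    rw [mul_pow, Real.sq_sqrt (by positivity)] at h2
    have h3 : c₁ * ‖x τ‖ ^ 2 < c₁ * η ^ 2 := by
      refine h1.trans_lt ((mul_lt_mul_of_pos_left h2 hc₂).trans_eq ?_)
      field_simp
    exact lt_of_pow_lt_pow_left₀ 2 hη.le (lt_of_mul_lt_mul_left h3 hc₁.le)
  · suffices hsq : Tendsto (fun τ => c₁ * ‖x τ‖ ^ 2) atTop (𝓝 0) by
      have h1 := ((hsq.const_mul c₁⁻¹).sqrt)
      rw [tendsto_zero_iff_norm_tendsto_zero]
      simpa [inv_mul_cancel_left₀ hc₁.ne', Real.sqrt_sq] using h1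
    -- With infinitely many impulses the powers of `ρ` give convergence; with finitely many, the
    -- exponential decay under the last frozen gain does.
    rcases eq_or_ne N ⊤ with rfl | hN
    · rw [Metric.tendsto_atTop]
      intro ε hε
      have hpow : Tendsto (fun d => ρ ^ d * (c₂ * ‖x s‖ ^ 2)) atTop (𝓝 0) := by
        simpa using (tendsto_pow_atTop_nhds_zero_of_lt_one hρ0 hρ1).mul_const (c₂ * ‖x s‖ ^ 2)
      obtain ⟨m, hm⟩ := (hpow.eventually (gt_mem_nhds hε)).exists
      refine ⟨max s (t (j + m)), fun τ hτ => ?_⟩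
      have hsτ := (le_max_left _ _).trans hτ
      obtain ⟨d, hd⟩ := hidx τ hsτ
      have hmd : j + m ≤ j + d := ht.le_index hT.le le_top ((le_max_right _ _).trans hτ) hd
      rw [Real.dist_eq, sub_zero, abs_of_nonneg (by positivity)]
      refine (hbound x hx d τ hsτ hd).trans_lt (lt_of_le_of_lt ?_ hm)
      exact mul_le_mul_of_nonneg_right
        (pow_le_pow_of_le_one hρ0 hρ1.le (by omega)) (by positivity)
    · lift N to ℕ using hN
      set u := max s (t N + T) with hu
      have hlast : ∀ τ, u ≤ τ → InInterval (N : ℕ∞) t N τ := fun τ hτ =>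
        ⟨le_rfl, by linarith [le_max_right s (t N + T)], fun h0 => by
          have : N + 1 ≤ N := by exact_mod_cast h0
          omega⟩
      have hlim : Tendsto (fun τ => Real.exp (-(α * (τ - u))) * quad P (x u)) atTop (𝓝 0) := by
        have h1 : Tendsto (fun τ => α * (τ - u)) atTop atTop :=
          (tendsto_atTop_add_const_right _ (-u) tendsto_id).const_mul_atTop hα
        simpa using (Real.tendsto_exp_neg_atTop_nhds_zero.comp h1).mul_const (quad P (x u))
      refine squeeze_zero' (Eventually.of_forall fun τ => by positivity) ?_ hlim
      filter_upwards [eventually_ge_atTop u] with τ hτ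
      have h1 := hx.quad_le_exp_mul hM hα' hT.le (le_max_right s (t N + T)) (le_max_left _ _) hτ
        (hlast τ hτ)
      have hTτ : T ≤ τ - t N := by linarith [le_max_right s (t N + T)]
      have h2 := hlow _ (hmem (τ - t N) (hT.le.trans hTτ)) (x τ)
      rw [← hQmin, hQT _ hTτ] at h2
      exact h2.trans h1

end Impulsive

theorem theorem6 {n mc md : ℕ} (A J : Matrix (Fin n) (Fin n) ℝ)
    (Bc : Matrix (Fin n) (Fin mc) ℝ) (Bd : Matrix (Fin n) (Fin md) ℝ) (T : ℝ) (hT : 0 < T) :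
    -- the two statements are equivalent
    ((∃ P Kd K, Impulsive.DwellTimeConditions A J Bc Bd T P Kd K) ↔
      (∃ S Uc Ud ε, Impulsive.DwellTimeLMIs A J Bc Bd T S Uc Ud ε)) ∧
    -- if the LMIs are feasible, they are so with all `S τ` invertible
    ((∃ S Uc Ud ε, Impulsive.DwellTimeLMIs A J Bc Bd T S Uc Ud ε) →
      ∃ S Uc Ud ε, Impulsive.DwellTimeLMIs A J Bc Bd T S Uc Ud ε ∧
        ∀ τ ∈ Icc 0 T, IsUnit (S τ)) ∧
    -- suitable gains retrieved from such a solution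
    (∀ S Uc Ud ε, Impulsive.DwellTimeLMIs A J Bc Bd T S Uc Ud ε →
      (∀ τ ∈ Icc 0 T, IsUnit (S τ)) →
      ∃ P, Impulsive.DwellTimeConditions A J Bc Bd T P
        (Ud * (S T)⁻¹) (fun τ => Uc τ * (S τ)⁻¹)) ∧
    -- stability under minimum dwell-time of the closed loop with suitable gains
    (∀ P Kd K, Impulsive.DwellTimeConditions A J Bc Bd T P Kd K →
      Impulsive.StableUnderMinDwellTime A J Bc Bd T (Impulsive.heldGain T K) Kd) := by
  refine ⟨⟨?_, ?_⟩, ?_, ?_, ?_⟩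
  · rintro ⟨P, Kd, K, h⟩
    exact h.exists_lmis hT.le
  · rintro ⟨S, Uc, Ud, ε, h⟩
    -- The given `S` may be singular, so gains are read off from the repaired solution.
    obtain ⟨S₁, Uc₁, h₁, hu⟩ := h.exists_isUnit hT.le
    exact ⟨_, _, _, h₁.exists_conditions hT.le hu⟩
  · rintro ⟨S, Uc, Ud, ε, h⟩
    obtain ⟨S₁, Uc₁, h₁, hu⟩ := h.exists_isUnit hT.le
    exact ⟨S₁, Uc₁, Ud, ε, h₁, hu⟩
  · intro S Uc Ud ε h hu
    exact ⟨_, h.exists_conditions hT.le hu⟩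
  · intro P Kd K h
    exact h.stable hT
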